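/- Let $S$ be a finite regular monoid (for every $s\in S$ there is $t\in S$ with $sts=s$) and let $k$ be a field whose characteristic does not divide the order of any maximal subgroup of $S$; here the maximal subgroup $G_e$ at an idempotent $e$ is the group of units of $eSe$. Write $s\le_{\mathscr J}t$, $s\le_{\mathscr R}t$, $s\le_{\mathscr L}t$ for $SsS\subseteq StS$, $sS\subseteq tS$, $Ss\subseteq St$, and let $\mathscr J,\mathscr R,\mathscr L$ be the associated equivalence relations. Let $J_1,\dots,J_n$ be the $\mathscr J$-classes of $S$, partially ordered by $\le_{\mathscr J}$. For each $i$ choose an idempotent $e_i\in J_i$ and put $G_i=G_{e_i}$; choose a complete set $T_i$ of representatives of the $\mathscr L$-classes of $J_i$ inside the $\mathscr R$-class of $e_i$, and a complete set $T_i'$ of representatives of the $\mathscr R$-classes of $J_i$ inside the $\mathscr L$-class of $e_i$. The sandwich matrix of $J_i$ is the $T_i\times T_i'$ matrix $C_i$ over $kG_i$ whose $(\lambda,\rho)$ entry is $\lambda\rho$ if $\lambda\rho\in J_i$ (in which case $\lambda\rho\in G_i$) and $0$ otherwise. All modules are right modules. For a $kG_i$-module $V$ let $\mathrm{Ind}_i(V)=V\otimes_{kG_i}e_i(kS/kI_i)$,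 a $kS$-module, where $I_i=\{s\in S: s\not\ge_{\mathscr J}e_i\}$. One says that $kS$ is directed if the characteristic of $k$ does not divide the order of any maximal subgroup of $S$ and, for all $i$ and all simple $kG_i$-modules $V$, the $kS$-module $\mathrm{Ind}_i(V)$ is projective. Then $kS$ is directed if and only if, for every $i$, the sandwich matrix $C_i$ is left invertible over $kG_i$ (that is, there is a $T_i'\times T_i$ matrix $D$ over $kG_i$ such that $DC_i$ is the identity matrix). In this case, the global dimension of $kS$ is at most $m-1$, where $m$ is the length (number of members) of the longest chain of nonzero $\mathscr J$-classes of $S$, that is, of $\mathscr J$-classes other than the class $\{0\}$ of a zero element of $S$, if there is one (the element of a one-element monoid is not regarded as a zero). -/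

import Mathlib

open scoped TensorProduct

universe u v w

noncomputable section

namespace RegularMonoid

/-! ### Green's relations of a monoid -/

section Green

variable {S : Type v} [Monoid S]

/-- `s ≤_J t`, that is `SsS ⊆ StS`. -/
def JLE (s t : S) : Prop := ∃ x y : S, s = x * t * y

/-- `s ≤_R t`, that is `sS ⊆ tS`. -/
def RLE (s t : S) : Prop := ∃ x : S, s = t * x

/-- `s ≤_L t`, that is `Ss ⊆ St`. -/
def LLE (s t : S) : Prop := ∃ x : S, s = x * t

/-- Green's relation `J`. -/
def JRel (s t : S) : Prop := JLE s t ∧ JLE t s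

/-- Green's relation `R`. -/
def RRel (s t : S) : Prop := RLE s t ∧ RLE t s

/-- Green's relation `L`. -/
def LRel (s t : S) : Prop := LLE s t ∧ LLE t s

theorem JLE.refl (s : S) : JLE s s := ⟨1, 1, by simp⟩

theorem JLE.trans {s t r : S} (h : JLE s t) (h' : JLE t r) : JLE s r := by
  obtain ⟨x, y, rfl⟩ := h
  obtain ⟨x', y', rfl⟩ := h'
  exact ⟨x * x', y' * y, by simp only [mul_assoc]⟩

variable (S) in
/-- The equivalence relation `J` on `S`. -/
def jSetoid : Setoid S where
  r := JRel
  iseqv :=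
    { refl := fun s => ⟨JLE.refl s, JLE.refl s⟩
      symm := fun h => ⟨h.2, h.1⟩
      trans := fun h h' => ⟨h.1.trans h'.1, h'.2.trans h.2⟩ }

variable (S) in
/-- The set `S / J` of `J`-classes. -/
def JClass : Type v := Quotient (jSetoid S)

/-- The `J`-class of an element. -/
def jClass (s : S) : JClass S := Quotient.mk (jSetoid S) s

/-- The partial order on `J`-classes induced by `≤_J`. -/
instance : PartialOrder (JClass S) where
  le a b := Quotient.liftOn₂ a b JLE fun _ _ _ _ h h' =>
    propext ⟨fun H => (h.2.trans H).trans h'.1, fun H => (h.1.trans H).trans h'.2⟩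
  le_refl a := Quotient.inductionOn a fun s => JLE.refl s
  le_trans a b c := Quotient.inductionOn₃ a b c fun _ _ _ h h' => JLE.trans h h'
  le_antisymm a b := Quotient.inductionOn₂ a b fun _ _ h h' => Quotient.sound ⟨h, h'⟩

variable (S) in
/-- The nonzero `J`-classes: all of them, except the class `{z}` of the zero element `z` of `S`
if there is one. As usual, the element of a one-element monoid is not regarded as a zero. -/
def nonzeroJClasses : Set (JClass S) :=
  {j | ¬ (Nontrivial S ∧ ∃ z : S, (∀ s : S, s * z = z ∧ z * s = z) ∧ jClass z = j)}

variable (S) in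
/-- The length (number of members) of the longest chain of nonzero `J`-classes. -/
def longestChain : ℕ∞ := (nonzeroJClasses S).chainHeight (· ≤ ·)

end Green

/-! ### Maximal subgroups -/

section MaximalSubgroup

variable {S : Type v} [Monoid S] {e : S}

/-- The local monoid `eSe` of an idempotent `e`, with identity `e`. -/
def LocalMonoid (_ : IsIdempotentElem e) : Type v := {x : S // e * x = x ∧ x * e = x}

instance (he : IsIdempotentElem e) : Monoid (LocalMonoid he) where
  mul x y := ⟨x.1 * y.1, by rw [← mul_assoc, x.2.1], by rw [mul_assoc, y.2.2]⟩
  one := ⟨e, he, he⟩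
  mul_assoc x y z := Subtype.ext (mul_assoc x.1 y.1 z.1)
  one_mul x := Subtype.ext x.2.1
  mul_one x := Subtype.ext x.2.2

instance [Finite S] (he : IsIdempotentElem e) : Finite (LocalMonoid he) :=
  inferInstanceAs (Finite {x : S // e * x = x ∧ x * e = x})

/-- The maximal subgroup `G_e` of `S` at `e`: the group of units of `eSe`. -/
abbrev MaximalSubgroup (he : IsIdempotentElem e) : Type v := (LocalMonoid he)ˣ

/-- The inclusion of `G_e` in `S`, as a multiplicative map (it sends the identity to `e`). -/
def MaximalSubgroup.incl (he : IsIdempotentElem e) : MaximalSubgroup he →ₙ* S where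
  toFun g := g.val.val
  map_mul' _ _ := rfl

/-- In a finite monoid, `J_e ∩ eSe = G_e`. -/
theorem exists_incl_eq [Finite S] (he : IsIdempotentElem e) {x : S} (h₁ : e * x = x)
    (h₂ : x * e = x) (h : JRel x e) : ∃ g : MaximalSubgroup he, MaximalSubgroup.incl he g = x := by
  obtain ⟨a, b, hab⟩ := h.2
  have hee : e * e = e := he
  let X : LocalMonoid he := ⟨x, h₁, h₂⟩
  let A : LocalMonoid he :=
    ⟨e * a * e, by simp only [← mul_assoc, hee], by simp only [mul_assoc, hee]⟩
  let B : LocalMonoid he :=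
    ⟨e * b * e, by simp only [← mul_assoc, hee], by simp only [mul_assoc, hee]⟩
  have key : A * X * B = 1 := by
    apply Subtype.ext
    change e * a * e * x * (e * b * e) = e
    calc e * a * e * x * (e * b * e) = e * (a * ((e * x) * e) * b) * e := by
          simp only [mul_assoc]
      _ = e := by rw [h₁, h₂, ← hab, hee, hee]
  have k₁ : X * (B * A) = 1 := by
    have := mul_eq_one_symm (a := A) (b := X * B) (by rw [← mul_assoc]; exact key)
    rw [← mul_assoc]; exact this
  exact ⟨⟨X, B * A, k₁, mul_eq_one_symm k₁⟩, rfl⟩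

end MaximalSubgroup

/-! ### Induced modules -/

section Induced

/-- For a `B`-`A`-bimodule `X` and a right `B`-module `V`, the right `A`-module `V ⊗_B X`: the
quotient of the tensor product over `ℤ` by the relations `vb ⊗ x = v ⊗ bx`. The two factors are
written in the opposite order, as the module structure of a tensor product in Mathlib is that of
its first factor. Right modules over a ring `R` are modules over `Rᵐᵒᵖ`. The relations are stable
under `A`, so that the `A`-submodule they span is also the additive subgroup they span. -/
abbrev BalancedTensor (A : Type*) [Ring A] (B : Type*) [Ring B] (V : Type*) [AddCommGroup V]
    [Module Bᵐᵒᵖ V] (X : Type*) [AddCommGroup X] [Module B X] [Module Aᵐᵒᵖ X] : Type _ :=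
  (X ⊗[ℤ] V) ⧸ Submodule.span Aᵐᵒᵖ
    {t : X ⊗[ℤ] V | ∃ (v : V) (b : B) (x : X), t = x ⊗ₜ[ℤ] (MulOpposite.op b • v) - (b • x) ⊗ₜ[ℤ] v}

variable (k : Type u) [Field k] {S : Type v} [Monoid S] {e : S}

/-- The ideal of `kS` spanned by the ideal `{s ∈ S | not s ≥_J e}` of `S` (its linear span is
already an ideal). -/
def notAboveIdeal (e : S) : Ideal (MonoidAlgebra k S) :=
  Ideal.span {x | ∃ s : S, ¬ JLE e s ∧ x = MonoidAlgebra.of k S s}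

instance (e : S) : (notAboveIdeal k e).IsTwoSided where
  mul_mem_of_left := by
    intro a b ha
    unfold notAboveIdeal at ha ⊢
    induction ha using Submodule.span_induction with
    | zero => simp
    | add x y _ _ hx hy => rw [add_mul]; exact add_mem hx hy
    | smul c x _ hx => rw [smul_eq_mul, mul_assoc]; exact Ideal.mul_mem_left _ c hx
    | mem x hx =>
      obtain ⟨s, hs, rfl⟩ := hx
      induction b using MonoidAlgebra.induction_on with
      | of t =>
        rw [← map_mul]
        refine Ideal.subset_span ⟨s * t, fun h => hs (h.trans ⟨1, t, by simp⟩), rfl⟩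
      | add x y hx hy => rw [mul_add]; exact add_mem hx hy
      | smul r y hy => rw [mul_smul_comm, ← smul_one_mul]; exact Ideal.mul_mem_left _ _ hy

/-- The quotient algebra of `kS` by the span of `{s ∈ S | not s ≥_J e}`. -/
abbrev QuotAlg (e : S) : Type (max u v) := MonoidAlgebra k S ⧸ notAboveIdeal k e

/-- The projection of `kS` onto its quotient algebra. -/
abbrev toQuot (e : S) : MonoidAlgebra k S →+* QuotAlg k e := Ideal.Quotient.mk (notAboveIdeal k e)

/-- The (non-unital) inclusion `kG_e → kS`. -/
def groupIncl (he : IsIdempotentElem e) :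
    MonoidAlgebra k (MaximalSubgroup he) →ₙ+* MonoidAlgebra k S :=
  MonoidAlgebra.mapDomainNonUnitalRingHom k (MaximalSubgroup.incl he)

theorem groupIncl_one (he : IsIdempotentElem e) : groupIncl k he 1 = MonoidAlgebra.of k S e := by
  rw [MonoidAlgebra.one_def]
  simp only [groupIncl, MonoidAlgebra.mapDomainNonUnitalRingHom_apply,
    MonoidAlgebra.mapDomain_single]
  rfl

theorem of_mul_groupIncl (he : IsIdempotentElem e) (b : MonoidAlgebra k (MaximalSubgroup he)) :
    groupIncl k he b = MonoidAlgebra.of k S e * groupIncl k he b := by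
  rw [← groupIncl_one k he, ← map_mul, one_mul]

/-- The underlying additive group of `e (kS / I)`, with `I` the span of `{s | not s ≥_J e}`. -/
def eQuotSubgroup (e : S) : AddSubgroup (QuotAlg k e) where
  carrier := {q | toQuot k e (MonoidAlgebra.of k S e) * q = q}
  zero_mem' := mul_zero _
  add_mem' {a b} ha hb := by
    change _ = _ at ha
    change _ = _ at hb
    change _ = _
    rw [mul_add, ha, hb]
  neg_mem' {a} ha := by
    change _ = _ at ha
    change _ = _
    rw [mul_neg, ha]

theorem mem_eQuotSubgroup {e : S} {q : QuotAlg k e} :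
    q ∈ eQuotSubgroup k e ↔ toQuot k e (MonoidAlgebra.of k S e) * q = q := Iff.rfl

/-- `e (kS / I)`, with `I` the span of `{s | not s ≥_J e}`, as a `kG_e`-`kS`-bimodule. -/
def EQuot (_ : IsIdempotentElem e) : Type (max u v) := eQuotSubgroup k e

instance (he : IsIdempotentElem e) : AddCommGroup (EQuot k he) :=
  inferInstanceAs (AddCommGroup (eQuotSubgroup k e))

/-- The right action of `kS` by multiplication. -/
instance (he : IsIdempotentElem e) : Module (MonoidAlgebra k S)ᵐᵒᵖ (EQuot k he) where
  smul a q := ⟨q.1 * toQuot k e a.unop, by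
    rw [mem_eQuotSubgroup, ← mul_assoc, (mem_eQuotSubgroup k).mp q.2]⟩
  one_smul q := Subtype.ext (by change q.1 * toQuot k e 1 = _; rw [map_one, mul_one])
  mul_smul a b q := Subtype.ext (by
    change q.1 * toQuot k e (b.unop * a.unop) = q.1 * toQuot k e b.unop * toQuot k e a.unop
    rw [map_mul, mul_assoc])
  smul_zero a := Subtype.ext (zero_mul _)
  zero_smul q := Subtype.ext (by change q.1 * toQuot k e 0 = 0; rw [map_zero, mul_zero])
  smul_add a p q := Subtype.ext (add_mul _ _ _)
  add_smul a b q := Subtype.ext (by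
    change q.1 * toQuot k e (a.unop + b.unop) = q.1 * toQuot k e a.unop + q.1 * toQuot k e b.unop
    rw [map_add, mul_add])

/-- The left action of `kG_e` by multiplication. -/
instance (he : IsIdempotentElem e) :
    Module (MonoidAlgebra k (MaximalSubgroup he)) (EQuot k he) where
  smul b q := ⟨toQuot k e (groupIncl k he b) * q.1, by
    rw [mem_eQuotSubgroup, ← mul_assoc, ← map_mul, ← of_mul_groupIncl]⟩
  one_smul q := Subtype.ext (by
    change toQuot k e (groupIncl k he 1) * q.1 = q.1
    rw [groupIncl_one]; exact q.2)
  mul_smul a b q := Subtype.ext (by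
    change toQuot k e (groupIncl k he (a * b)) * q.1 =
      toQuot k e (groupIncl k he a) * (toQuot k e (groupIncl k he b) * q.1)
    rw [map_mul, map_mul, mul_assoc])
  smul_zero a := Subtype.ext (mul_zero _)
  zero_smul q := Subtype.ext (by
    change toQuot k e (groupIncl k he 0) * q.1 = 0
    rw [map_zero, map_zero, zero_mul])
  smul_add a p q := Subtype.ext (mul_add _ _ _)
  add_smul a b q := Subtype.ext (by
    change toQuot k e (groupIncl k he (a + b)) * q.1 =
      toQuot k e (groupIncl k he a) * q.1 + toQuot k e (groupIncl k he b) * q.1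
    rw [map_add, map_add, add_mul])

/-- The two actions commute. -/
instance (he : IsIdempotentElem e) :
    SMulCommClass (MonoidAlgebra k (MaximalSubgroup he)) (MonoidAlgebra k S)ᵐᵒᵖ (EQuot k he) where
  smul_comm b _ q := Subtype.ext (mul_assoc (toQuot k e (groupIncl k he b)) q.1 _).symm

/-- The induced right `kS`-module `Ind_e(V) = V ⊗_{kG_e} e (kS / I)` of a right `kG_e`-module `V`,
where `I` is the span of `{s ∈ S | not s ≥_J e}`. -/
abbrev Ind (he : IsIdempotentElem e) (V : Type w) [AddCommGroup V]
    [Module (MonoidAlgebra k (MaximalSubgroup he))ᵐᵒᵖ V] : Type (max u v w) :=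
  BalancedTensor (MonoidAlgebra k S) (MonoidAlgebra k (MaximalSubgroup he)) V (EQuot k he)

end Induced

/-! ### Representatives, directedness and sandwich matrices -/

/-- A choice, for each `J`-class `j`, of an idempotent `e j` in `j`, of a complete set `T j` of
representatives of the `L`-classes of `j` inside the `R`-class of `e j`, and of a complete set
`T' j` of representatives of the `R`-classes of `j` inside the `L`-class of `e j`. -/
structure Representatives (S : Type v) [Monoid S] where
  e : JClass S → S
  idem : ∀ j, IsIdempotentElem (e j)
  mem : ∀ j, jClass (e j) = j
  T : JClass S → Finset S
  T_sub : ∀ j, ∀ t ∈ T j, RRel t (e j)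
  T_rep : ∀ j (s : S), jClass s = j → ∃! t, t ∈ T j ∧ LRel t s
  T' : JClass S → Finset S
  T'_sub : ∀ j, ∀ t ∈ T' j, LRel t (e j)
  T'_rep : ∀ j (s : S), jClass s = j → ∃! t, t ∈ T' j ∧ RRel t s

/-- The characteristic of `k` does not divide the order of any maximal subgroup of `S`. -/
def GoodChar (k : Type u) [Field k] (S : Type v) [Monoid S] : Prop :=
  ∀ (e : S) (he : IsIdempotentElem e), ¬ ringChar k ∣ Nat.card (MaximalSubgroup he)

namespace Representatives

variable {S : Type v} [Monoid S] (c : Representatives S) (k : Type u) [Field k]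

/-- The maximal subgroup `G_j` at the chosen idempotent of the `J`-class `j`. -/
abbrev G (j : JClass S) : Type v := MaximalSubgroup (c.idem j)

/-- `kS` is directed: the characteristic of `k` is good and every induced module `Ind_j(V)`, with
`V` a simple right `kG_j`-module, is a projective right `kS`-module. (Simple `kG_j`-modules are
quotients of `kG_j`, so the universe of `V` is no restriction.) -/
def IsDirected : Prop :=
  GoodChar k S ∧ ∀ (j : JClass S) (V : Type (max u v)) [AddCommGroup V]
    [Module (MonoidAlgebra k (c.G j))ᵐᵒᵖ V], IsSimpleModule (MonoidAlgebra k (c.G j))ᵐᵒᵖ V →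
      Module.Projective (MonoidAlgebra k S)ᵐᵒᵖ (Ind k (c.idem j) V)

theorem T_mul_T' (j : JClass S) {x y : S} (hx : x ∈ c.T j) (hy : y ∈ c.T' j) :
    c.e j * (x * y) = x * y ∧ x * y * c.e j = x * y := by
  have he : c.e j * c.e j = c.e j := c.idem j
  obtain ⟨a, ha⟩ := (c.T_sub j x hx).1
  obtain ⟨b, hb⟩ := (c.T'_sub j y hy).1
  constructor
  · rw [← mul_assoc]; conv_lhs => rw [ha, ← mul_assoc, he, ← ha]
  · rw [mul_assoc]; conv_lhs => rw [hb, mul_assoc, he, ← hb]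

open Classical in
/-- The sandwich matrix of the `J`-class `j`: its rows are indexed by the `L`-classes `b` of `j` and
its columns by the `R`-classes `a` of `j`, and its entry at `(b, a)` is the product `λ_b ρ_a` of the
representatives if this lies in `j` (and then it is an element of `G_j`), and `0` otherwise. -/
def sandwich [Finite S] (j : JClass S) :
    Matrix (c.T j) (c.T' j) (MonoidAlgebra k (c.G j)) := fun b a =>
  if h : JRel (b.1 * a.1) (c.e j) then
    MonoidAlgebra.of k (c.G j) (exists_incl_eq (c.idem j) (c.T_mul_T' j b.2 a.2).1
      (c.T_mul_T' j b.2 a.2).2 h).choose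
  else 0

end Representatives

open Classical in
/-- A matrix over a (noncommutative) ring is left invertible. -/
def LeftInvertible {R m n : Type*} [Ring R] [Fintype m] [Fintype n] (C : Matrix m n R) : Prop :=
  ∃ D : Matrix n m R, D * C = 1

/-- The global dimension of a ring, through its right modules. -/
def globalDimension (A : Type w) [Ring A] : WithBot ℕ∞ :=
  ⨆ M : ModuleCat.{w} Aᵐᵒᵖ, CategoryTheory.projectiveDimension M

end RegularMonoid

end

/-!
The proof compares both conditions with a third one: for every ideal `D` of `S`, the span `kD` has
a left identity, that is, an element `η ∈ kD` with `ηy = y` for all `y ∈ kD`.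

* *Sandwich matrices and left identities.* Modulo the elements strictly below a `J`-class `j`, the
  span of `j` is the space of `T'_j × T_j` matrices over `kG_j`, with multiplication `M C_j N`
  (`exists_coordinates`, `ofMatrix_mul_sub_mem`, `eq_zero_of_sum_mem`). So a left identity of this
  layer is the same as a left inverse of `C_j`. Left identities of consecutive layers combine
  (`HasLeftIdentity.extend`), and induction over the ideals of `S` gives
  `hasLeftIdentity_of_sandwich`; the converse is `leftInvertible_of_hasLeftIdentity`.
* *Projectivity and left identities.* As `kG_j` is semisimple, all `Ind_j(V)` with `V` simple are
  projective if and only if `e_j(kS/kI_j)`, which is `Ind_j(kG_j)`, is projective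
  (`BalancedTensor.projective`, `BalancedTensor.projective_of_simple`). A left identity `η` of
  `kI_j` splits the projection `kS → e_j(kS/kI_j)`, by `q ↦ (1 - η)q`. Conversely, a splitting
  yields a lift `f` of `e_j` with `f I_j = 0`. An element `x e_j y` of `j` may then be corrected by
  `x f y`, which turns a left identity of `k(D ∪ j)` into one of `kD`, where `j` is minimal outside
  `D`; hence all `kD` have left identities, by induction from `S` downwards
  (`hasLeftIdentity_of_projective`).
* *Global dimension.* Let `M` be a right `kS`-module on which only the `J`-classes of an upper set
  `U` act nontrivially, and let `j` be minimal in `U`. The canonical map `Ind_j(M e_j) → M` has a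
  projective source; its kernel is acted on only by the classes strictly above `j`, because
  `Ind_j(V) e_j = V`, and its cokernel only by the classes in `U \ {j}`. By induction on `U`, the
  projective dimension of `M` is less than the length of the longest chain in `U`
  (`hasProjectiveDimensionLT_of_upperSet`). If `S` has a zero, the canonical map of its class is
  injective, so that this class does not count.
-/

noncomputable section

namespace RegularMonoid

/-! ### Ideals of `S` and their linear spans -/

section Ideals

variable {S : Type v} [Monoid S]

/-- A (possibly empty) two-sided ideal of `S`, expressed as a lower set of the `J`-preorder. -/
def IsIdealSet (D : Set S) : Prop := ∀ ⦃s t : S⦄, JLE s t → t ∈ D → s ∈ D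

theorem JLE.mul_left (s t : S) : JLE (s * t) t := ⟨s, 1, by simp⟩

theorem JLE.mul_right (s t : S) : JLE (s * t) s := ⟨1, t, by simp⟩

theorem RLE.jle {s t : S} (h : RLE s t) : JLE s t := by
  obtain ⟨x, rfl⟩ := h
  exact JLE.mul_right _ _

theorem LLE.jle {s t : S} (h : LLE s t) : JLE s t := by
  obtain ⟨x, rfl⟩ := h
  exact JLE.mul_left _ _

theorem jClass_eq_iff {s t : S} : jClass s = jClass t ↔ JRel s t := Quotient.eq (r := jSetoid S)

theorem jClass_le_iff {s t : S} : jClass s ≤ jClass t ↔ JLE s t := Iff.rfl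

theorem isIdealSet_notAbove (e : S) : IsIdealSet {s : S | ¬ JLE e s} :=
  fun _ _ hst ht he => ht (he.trans hst)

theorem isIdealSet_below (e : S) : IsIdealSet {s : S | JLE s e} := fun _ _ hst ht => hst.trans ht

theorem isIdealSet_strictlyBelow (e : S) : IsIdealSet {s : S | JLE s e ∧ ¬ JLE e s} :=
  fun _ _ hst ht => ⟨hst.trans ht.1, fun he => ht.2 (he.trans hst)⟩

variable (k : Type u) [Field k]

/-- The linear span of a set of monoid elements in `kS`. -/
def spanOf (D : Set S) : Submodule k (MonoidAlgebra k S) :=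
  Submodule.span k (MonoidAlgebra.of k S '' D)

variable {k}

theorem of_mem_spanOf {D : Set S} {s : S} (hs : s ∈ D) : MonoidAlgebra.of k S s ∈ spanOf k D :=
  Submodule.subset_span ⟨s, hs, rfl⟩

theorem spanOf_mono {D D' : Set S} (h : D ⊆ D') : spanOf k D ≤ spanOf k D' :=
  Submodule.span_mono (Set.image_mono h)

theorem mem_spanOf_univ (x : MonoidAlgebra k S) : x ∈ spanOf k (Set.univ : Set S) := by
  induction x using MonoidAlgebra.induction_on with
  | of t => exact of_mem_spanOf trivial
  | add x y hx hy => exact add_mem hx hy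
  | smul r y hy => exact Submodule.smul_mem _ _ hy

theorem coeff_eq_zero_of_mem_spanOf {D : Set S} {x : MonoidAlgebra k S} (hx : x ∈ spanOf k D)
    {s : S} (hs : s ∉ D) : x.coeff s = 0 := by
  classical
  unfold spanOf at hx
  induction hx using Submodule.span_induction with
  | zero => simp
  | add x y _ _ hx hy => simp [hx, hy]
  | smul c x _ hx => simp [hx]
  | mem x hx =>
    obtain ⟨t, ht, rfl⟩ := hx
    have : t ≠ s := fun h => hs (h ▸ ht)
    simp [MonoidAlgebra.of_apply, this]

/-- Two-sided multiplication maps a span into a submodule as soon as it does so on the elements. -/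
theorem mul_mul_mem_of_forall {D : Set S} {N : Submodule k (MonoidAlgebra k S)}
    {a b : MonoidAlgebra k S} (h : ∀ s ∈ D, a * MonoidAlgebra.of k S s * b ∈ N)
    {x : MonoidAlgebra k S} (hx : x ∈ spanOf k D) : a * x * b ∈ N := by
  unfold spanOf at hx
  induction hx using Submodule.span_induction with
  | zero => simp
  | add x y _ _ hx hy => rw [mul_add, add_mul]; exact add_mem hx hy
  | smul c x _ hx => rw [mul_smul_comm, smul_mul_assoc]; exact Submodule.smul_mem _ _ hx
  | mem x hx =>
    obtain ⟨t, ht, rfl⟩ := hx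
    exact h t ht

theorem mul_mem_of_forall {D : Set S} {N : Submodule k (MonoidAlgebra k S)}
    {a : MonoidAlgebra k S} (h : ∀ s ∈ D, a * MonoidAlgebra.of k S s ∈ N)
    {x : MonoidAlgebra k S} (hx : x ∈ spanOf k D) : a * x ∈ N := by
  rw [← mul_one (a * x)]
  exact mul_mul_mem_of_forall (fun s hs => by rw [mul_one]; exact h s hs) hx

theorem mem_mul_of_forall {D : Set S} {N : Submodule k (MonoidAlgebra k S)}
    {b : MonoidAlgebra k S} (h : ∀ s ∈ D, MonoidAlgebra.of k S s * b ∈ N)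
    {x : MonoidAlgebra k S} (hx : x ∈ spanOf k D) : x * b ∈ N := by
  rw [← one_mul x]
  exact mul_mul_mem_of_forall (fun s hs => by rw [one_mul]; exact h s hs) hx

theorem IsIdealSet.mul_mem_left {D : Set S} (hD : IsIdealSet D) {x : MonoidAlgebra k S}
    (hx : x ∈ spanOf k D) (a : MonoidAlgebra k S) : a * x ∈ spanOf k D :=
  mem_mul_of_forall (fun t _ => mul_mem_of_forall (fun s hs => by
    rw [← map_mul]; exact of_mem_spanOf (hD (JLE.mul_left t s) hs)) hx) (mem_spanOf_univ a)

theorem IsIdealSet.mul_mem_right {D : Set S} (hD : IsIdealSet D) {x : MonoidAlgebra k S}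
    (hx : x ∈ spanOf k D) (a : MonoidAlgebra k S) : x * a ∈ spanOf k D :=
  mul_mem_of_forall (fun t _ => mem_mul_of_forall (fun s hs => by
    rw [← map_mul]; exact of_mem_spanOf (hD (JLE.mul_right s t) hs)) hx) (mem_spanOf_univ a)

theorem mem_notAboveIdeal {e : S} {x : MonoidAlgebra k S} :
    x ∈ notAboveIdeal k e ↔ x ∈ spanOf k {s : S | ¬ JLE e s} := by
  constructor
  · intro hx
    unfold notAboveIdeal at hx
    induction hx using Submodule.span_induction with
    | zero => exact zero_mem _
    | add x y _ _ hx hy => exact add_mem hx hy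
    | smul c x _ hx => exact (isIdealSet_notAbove e).mul_mem_left hx c
    | mem x hx =>
      obtain ⟨s, hs, rfl⟩ := hx
      exact of_mem_spanOf hs
  · intro hx
    unfold spanOf at hx
    induction hx using Submodule.span_induction with
    | zero => exact zero_mem _
    | add x y _ _ hx hy => exact add_mem hx hy
    | smul c x _ hx => rw [← smul_one_mul]; exact Ideal.mul_mem_left _ _ hx
    | mem x hx =>
      obtain ⟨s, hs, rfl⟩ := hx
      exact Ideal.subset_span ⟨s, hs, rfl⟩

theorem toQuot_eq_iff {e : S} {x y : MonoidAlgebra k S} :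
    toQuot k e x = toQuot k e y ↔ x - y ∈ spanOf k {s : S | ¬ JLE e s} := by
  rw [Ideal.Quotient.mk_eq_mk_iff_sub_mem, mem_notAboveIdeal]

variable (k) in
/-- The span of an ideal of `S` has a left identity, given by an element of the span. -/
def HasLeftIdentity (D : Set S) : Prop :=
  ∃ η ∈ spanOf k D, ∀ y ∈ spanOf k D, η * y = y

end Ideals

/-! ### Balanced tensor products and their projectivity -/

section BalancedTensor

open MulOpposite

variable {A : Type*} [Ring A] {B : Type*} [Ring B] {V : Type*} [AddCommGroup V]
  [Module Bᵐᵒᵖ V] {X : Type*} [AddCommGroup X] [Module B X] [Module Aᵐᵒᵖ X]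

namespace BalancedTensor

variable (A B) in
/-- The class of the pure tensor `v ⊗ x`. -/
def pure (x : X) (v : V) : BalancedTensor A B V X := Submodule.Quotient.mk (x ⊗ₜ[ℤ] v)

theorem pure_add_left (x y : X) (v : V) : pure A B (x + y) v = pure A B x v + pure A B y v := by
  simp only [pure, TensorProduct.add_tmul, Submodule.Quotient.mk_add]

theorem pure_add_right (x : X) (v w : V) : pure A B x (v + w) = pure A B x v + pure A B x w := by
  simp only [pure, TensorProduct.tmul_add, Submodule.Quotient.mk_add]

theorem pure_zero_left (v : V) : pure A B (0 : X) v = 0 := by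
  simp only [pure, TensorProduct.zero_tmul, Submodule.Quotient.mk_zero]

theorem pure_zero_right (x : X) : pure A B x (0 : V) = 0 := by
  simp only [pure, TensorProduct.tmul_zero, Submodule.Quotient.mk_zero]

theorem pure_sum_right {ι : Type*} (x : X) (f : ι → V) (s : Finset ι) :
    pure A B x (∑ i ∈ s, f i) = ∑ i ∈ s, pure A B x (f i) :=
  map_sum (AddMonoidHom.mk' (pure A B x) (pure_add_right x)) f s

theorem pure_smul_left (a : Aᵐᵒᵖ) (x : X) (v : V) : pure A B (a • x) v = a • pure A B x v := rfl

theorem pure_balanced (b : B) (x : X) (v : V) :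
    pure A B x (op b • v) = pure A B (b • x) v :=
  (Submodule.Quotient.eq _).mpr (Submodule.subset_span ⟨v, b, x, rfl⟩)

@[elab_as_elim]
theorem induction {p : BalancedTensor A B V X → Prop} (t : BalancedTensor A B V X)
    (h0 : p 0) (hadd : ∀ s t, p s → p t → p (s + t)) (hpure : ∀ x v, p (pure A B x v)) : p t := by
  induction t using Submodule.Quotient.induction_on with
  | H z =>
    induction z using TensorProduct.induction_on with
    | zero => exact h0
    | tmul x y => exact hpure x y
    | add x y hx hy => exact hadd _ _ hx hy

/-- The universal property: a biadditive map which is balanced over `B` and `A`-linear in the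
bimodule variable factors through the balanced tensor product. -/
def lift {P : Type*} [AddCommGroup P] [Module Aᵐᵒᵖ P] (f : X → V → P)
    (hl : ∀ x y v, f (x + y) v = f x v + f y v) (hr : ∀ x v w, f x (v + w) = f x v + f x w)
    (hs : ∀ (a : Aᵐᵒᵖ) x v, f (a • x) v = a • f x v)
    (hb : ∀ (b : B) x v, f x (op b • v) = f (b • x) v) : BalancedTensor A B V X →ₗ[Aᵐᵒᵖ] P :=
  Submodule.liftQ _ (TensorProduct.AlgebraTensorModule.lift
    { toFun := fun x => (AddMonoidHom.mk' (f x) (hr x)).toIntLinearMap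
      map_add' := fun x y => LinearMap.ext fun v => hl x y v
      map_smul' := fun a x => LinearMap.ext fun v => hs a x v } : X ⊗[ℤ] V →ₗ[Aᵐᵒᵖ] P) (by
    rw [Submodule.span_le]
    rintro _ ⟨v, b, x, rfl⟩
    change _ = _
    rw [map_sub]
    exact sub_eq_zero.mpr (hb b x v))

@[simp]
theorem lift_pure {P : Type*} [AddCommGroup P] [Module Aᵐᵒᵖ P] (f : X → V → P) (hl hr hs hb)
    (x : X) (v : V) : lift (A := A) (B := B) f hl hr hs hb (pure A B x v) = f x v := rfl

/-- `x ↦ v ⊗ x` as a linear map. -/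
def pureLeft (v : V) : X →ₗ[Aᵐᵒᵖ] BalancedTensor A B V X where
  toFun x := pure A B x v
  map_add' x y := pure_add_left x y v
  map_smul' _ _ := rfl

/-- As `V` is a retract of the free module on its underlying set, `V ⊗_B X` is a retract of the
direct sum of copies of `X` indexed by that set. -/
theorem projective [SMulCommClass B Aᵐᵒᵖ X] [Module.Projective Bᵐᵒᵖ V]
    [Module.Projective Aᵐᵒᵖ X] : Module.Projective Aᵐᵒᵖ (BalancedTensor A B V X) := by
  classical
  obtain ⟨s, hs⟩ := (Module.Projective.out : ∃ s : V →ₗ[Bᵐᵒᵖ] V →₀ Bᵐᵒᵖ, _)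
  let i : BalancedTensor A B V X →ₗ[Aᵐᵒᵖ] Π₀ _ : V, X := lift
    (fun x v => (s v).toDFinsupp.mapRange (fun _ (b : Bᵐᵒᵖ) => b.unop • x) (by simp))
    (fun x y v => by ext w; simp)
    (fun x v w => by ext w; simp [add_smul])
    (fun a x v => by ext w; simp [smul_comm])
    (fun b x v => by ext w; simp [mul_smul])
  let p : (Π₀ _ : V, X) →ₗ[Aᵐᵒᵖ] BalancedTensor A B V X := DFinsupp.lsum ℕ fun v => pureLeft v
  refine Module.Projective.of_split i p (LinearMap.ext fun t => ?_)
  induction t using induction with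
  | h0 => simp
  | hadd t t' ht ht' => rw [map_add, ht, ht', map_add]
  | hpure x v =>
    have hv : (s v).sum (fun w b => b • w) = v := by
      simpa [Finsupp.linearCombination_apply] using hs v
    have : i (pure A B x v) = (s v).sum fun w b => DFinsupp.single w (b.unop • x) := by
      ext w
      simp only [i, lift_pure, DFinsupp.mapRange_apply, Finsupp.toDFinsupp_coe, Finsupp.sum,
        DFinsupp.finsetSum_apply, DFinsupp.single_apply]
      by_cases hw : s v w = 0
      · simp [hw]
      · rw [Finset.sum_eq_single w] <;> simp_all
    rw [LinearMap.comp_apply, this, Finsupp.sum, map_sum]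
    conv_rhs => rw [LinearMap.id_apply, ← hv, Finsupp.sum]
    rw [pure_sum_right]
    refine Finset.sum_congr rfl fun w _ => ?_
    rw [← op_unop (s v w), pure_balanced]
    exact DFinsupp.lsum_single (R := Aᵐᵒᵖ) ℕ (fun v => pureLeft v) w _

/-- If `1` is a sum of elements of simple right ideals `Vᵢ` of `B`, then `X` is a retract of the
product of the modules `Vᵢ ⊗_B X`. -/
theorem projective_of_simple [SMulCommClass B Aᵐᵒᵖ X] [IsSemisimpleRing Bᵐᵒᵖ]
    (h : ∀ V : Submodule Bᵐᵒᵖ Bᵐᵒᵖ, IsSimpleModule Bᵐᵒᵖ V →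
      Module.Projective Aᵐᵒᵖ (BalancedTensor A B V X)) : Module.Projective Aᵐᵒᵖ X := by
  classical
  have h1 : (1 : Bᵐᵒᵖ) ∈ sSup {m : Submodule Bᵐᵒᵖ Bᵐᵒᵖ | IsSimpleModule Bᵐᵒᵖ m} := by
    rw [IsSemisimpleModule.sSup_simples_eq_top]; trivial
  rw [sSup_eq_iSup', Submodule.mem_iSup_iff_exists_dfinsupp] at h1
  obtain ⟨ε, hε⟩ := h1
  have (V : {m : Submodule Bᵐᵒᵖ Bᵐᵒᵖ | IsSimpleModule Bᵐᵒᵖ m}) :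
    Module.Projective Aᵐᵒᵖ (BalancedTensor A B V.1 X) := h V.1 V.2
  let act (V : {m : Submodule Bᵐᵒᵖ Bᵐᵒᵖ | IsSimpleModule Bᵐᵒᵖ m}) :
      BalancedTensor A B V.1 X →ₗ[Aᵐᵒᵖ] X :=
    lift (fun x v => v.1.unop • x) (fun x y v => smul_add _ _ _)
      (fun x v w => by simp [add_smul]) (fun a x v => smul_comm _ _ _)
      (fun b x v => by simp [mul_smul])
  let i : X →ₗ[Aᵐᵒᵖ] Π₀ V : {m : Submodule Bᵐᵒᵖ Bᵐᵒᵖ | IsSimpleModule Bᵐᵒᵖ m},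
      BalancedTensor A B V.1 X := ∑ V ∈ ε.support, DFinsupp.lsingle V ∘ₗ pureLeft (ε V)
  refine Module.Projective.of_split i (DFinsupp.lsum ℕ act) (LinearMap.ext fun x => ?_)
  simp only [i, LinearMap.comp_apply, LinearMap.sum_apply, map_sum, LinearMap.id_apply]
  have hε' : ∑ V ∈ ε.support, (ε V).1 = 1 := by
    simpa [DFinsupp.lsum_apply_apply, DFinsupp.sumAddHom_apply, DFinsupp.sum] using hε
  conv_rhs => rw [← one_smul B x, ← unop_one, ← hε', Finset.unop_sum, Finset.sum_smul]
  refine Finset.sum_congr rfl fun V _ => ?_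
  exact (DFinsupp.lsum_single (R := Aᵐᵒᵖ) ℕ act V _).trans rfl

end BalancedTensor

end BalancedTensor

/-! ### Left identities and sandwich matrices -/

section LeftIdentity

variable {k : Type u} [Field k] {S : Type v} [Monoid S]

open MonoidAlgebra (of)

@[simp]
theorem groupIncl_of {e : S} (he : IsIdempotentElem e) (g : MaximalSubgroup he) :
    groupIncl k he (of k _ g) = of k S (MaximalSubgroup.incl he g) := by
  simp only [groupIncl, MonoidAlgebra.mapDomainNonUnitalRingHom_apply,
    MonoidAlgebra.mapDomain_single, MonoidAlgebra.of_apply]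

theorem groupIncl_smul {e : S} (he : IsIdempotentElem e) (r : k)
    (x : MonoidAlgebra k (MaximalSubgroup he)) : groupIncl k he (r • x) = r • groupIncl k he x := by
  simp only [groupIncl, MonoidAlgebra.mapDomainNonUnitalRingHom_apply]
  exact MonoidAlgebra.mapDomain_smul _ _ _

theorem groupIncl_mul_of {e : S} (he : IsIdempotentElem e)
    (b : MonoidAlgebra k (MaximalSubgroup he)) : groupIncl k he b * of k S e = groupIncl k he b := by
  rw [← groupIncl_one k he, ← map_mul, mul_one]

/-- Left identities for two consecutive layers combine: if `η` is a left identity of `kD'` and `ε`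
is one of `kD` modulo `kD'`, then `1 - (1 - η)(1 - ε)` is a left identity of `kD`. -/
theorem HasLeftIdentity.extend {D D' : Set S} (hD : IsIdealSet D) (hsub : D' ⊆ D)
    (h : HasLeftIdentity k D') {ε : MonoidAlgebra k S} (hε : ε ∈ spanOf k D)
    (hmod : ∀ s ∈ D, ε * of k S s - of k S s ∈ spanOf k D') : HasLeftIdentity k D := by
  obtain ⟨η, hη, hid⟩ := h
  have hη' := spanOf_mono hsub hη
  refine ⟨η + ε - η * ε, sub_mem (add_mem hη' hε) (hD.mul_mem_right hη' ε), fun y hy => ?_⟩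
  have hy' : (ε - 1) * y ∈ spanOf k D' :=
    mul_mem_of_forall (fun s hs => by rw [sub_mul, one_mul]; exact hmod s hs) hy
  have := hid _ hy'
  calc (η + ε - η * ε) * y = η * y + (ε - 1) * y - η * ((ε - 1) * y) + (1 - η) * y := by
        noncomm_ring
    _ = y := by rw [this]; noncomm_ring

end LeftIdentity

namespace Representatives

variable {S : Type v} [Monoid S] (c : Representatives S) {k : Type u} [Field k]

open MonoidAlgebra (of)

theorem jRel_of_mem_T {j : JClass S} {t : S} (ht : t ∈ c.T j) : JRel t (c.e j) :=
  ⟨(c.T_sub j t ht).1.jle, (c.T_sub j t ht).2.jle⟩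

theorem jRel_of_mem_T' {j : JClass S} {t : S} (ht : t ∈ c.T' j) : JRel t (c.e j) :=
  ⟨(c.T'_sub j t ht).1.jle, (c.T'_sub j t ht).2.jle⟩

theorem e_mul_of_mem_T {j : JClass S} {t : S} (ht : t ∈ c.T j) : c.e j * t = t := by
  obtain ⟨x, rfl⟩ := (c.T_sub j t ht).1
  rw [← mul_assoc, c.idem j]

theorem mul_e_of_mem_T' {j : JClass S} {t : S} (ht : t ∈ c.T' j) : t * c.e j = t := by
  obtain ⟨x, rfl⟩ := (c.T'_sub j t ht).1
  rw [mul_assoc, c.idem j]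

/-- The matrix coefficients of the sandwich matrix are the products `λρ` modulo the elements
strictly below the `J`-class. -/
theorem of_mul_of_sub_sandwich_mem [Finite S] (j : JClass S) (b : c.T j) (a : c.T' j) :
    of k S b.1 * of k S a.1 - groupIncl k (c.idem j) (c.sandwich k j b a) ∈
      spanOf k {s : S | JLE s (c.e j) ∧ ¬ JLE (c.e j) s} := by
  unfold sandwich
  split_ifs with h
  · rw [groupIncl_of, (exists_incl_eq (c.idem j) (c.T_mul_T' j b.2 a.2).1
      (c.T_mul_T' j b.2 a.2).2 h).choose_spec, map_mul, sub_self]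
    exact zero_mem _
  · have hle : JLE (b.1 * a.1) (c.e j) := (JLE.mul_right _ _).trans (c.jRel_of_mem_T b.2).1
    rw [map_zero, sub_zero, ← map_mul]
    exact of_mem_spanOf ⟨hle, fun h' => h ⟨hle, h'⟩⟩

/-- The element of `kS` with coordinate matrix `M` over `kG_j`, in the coordinates
`T'_j × G_j × T_j` of the `J`-class `j`. -/
def ofMatrix (j : JClass S) (M : Matrix (c.T' j) (c.T j) (MonoidAlgebra k (c.G j))) :
    MonoidAlgebra k S :=
  ∑ a, ∑ b, of k S a.1 * groupIncl k (c.idem j) (M a b) * of k S b.1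

theorem ofMatrix_mem (j : JClass S) (M : Matrix (c.T' j) (c.T j) (MonoidAlgebra k (c.G j))) :
    c.ofMatrix j M ∈ spanOf k {s : S | JLE s (c.e j)} :=
  sum_mem fun a _ => sum_mem fun _ _ => (isIdealSet_below _).mul_mem_right
    ((isIdealSet_below _).mul_mem_right (of_mem_spanOf (c.jRel_of_mem_T' a.2).1) _) _

/-- Multiplying by a representative `ρ` amounts, modulo the elements strictly below the `J`-class,
to multiplying the coordinate matrix by the sandwich matrix. -/
theorem ofMatrix_mul_sub_mem [Finite S] (j : JClass S)
    (M : Matrix (c.T' j) (c.T j) (MonoidAlgebra k (c.G j))) (a : c.T' j) :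
    c.ofMatrix j M * of k S a.1 -
        ∑ a', of k S a'.1 * groupIncl k (c.idem j) ((M * c.sandwich k j) a' a) ∈
      spanOf k {s : S | JLE s (c.e j) ∧ ¬ JLE (c.e j) s} := by
  simp only [ofMatrix, Finset.sum_mul, Matrix.mul_apply, map_sum, Finset.mul_sum]
  rw [← Finset.sum_sub_distrib]
  refine sum_mem fun a' _ => ?_
  rw [← Finset.sum_sub_distrib]
  refine sum_mem fun b _ => ?_
  rw [map_mul, ← mul_assoc, mul_assoc _ (of k S b.1), ← mul_sub]
  exact (isIdealSet_strictlyBelow _).mul_mem_left (c.of_mul_of_sub_sandwich_mem j b a) _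

theorem sum_of_mul_one {j : JClass S} [DecidableEq (c.T' j)] (a : c.T' j) :
    ∑ a', of k S a'.1 * groupIncl k (c.idem j) ((1 : Matrix (c.T' j) (c.T' j) _) a' a) =
      of k S a.1 := by
  rw [Finset.sum_eq_single_of_mem a (Finset.mem_univ _)]
  · rw [Matrix.one_apply_eq, groupIncl_one, ← map_mul, c.mul_e_of_mem_T' a.2]
  · intro b _ hb
    rw [Matrix.one_apply_ne hb, map_zero, mul_zero]

/-- Left inverses of the sandwich matrices assemble to left identities of all ideals: a left
inverse is the coordinate matrix of a left identity of one `J`-class modulo the lower ones. -/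
theorem hasLeftIdentity_of_sandwich [Finite S]
    (h : ∀ j, LeftInvertible (c.sandwich k j)) (D : Set S) (hD : IsIdealSet D) :
    HasLeftIdentity k D := by
  induction D using WellFoundedLT.induction with
  | ind D ih =>
    rcases D.eq_empty_or_nonempty with rfl | hne
    · refine ⟨0, zero_mem _, fun y hy => ?_⟩
      rw [spanOf, Set.image_empty, Submodule.span_empty, Submodule.mem_bot] at hy
      rw [hy, mul_zero]
    obtain ⟨s, hsD, hmax⟩ := D.toFinite.exists_maximalFor jClass D hne
    set j := jClass s
    have hej : JRel (c.e j) s := jClass_eq_iff.mp (c.mem j)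
    have hD' : IsIdealSet (D \ {t | JRel t (c.e j)}) := fun t r htr hr =>
      ⟨hD htr hr.1, fun ht => hr.2 (by
        have h₁ : JLE s r := hej.2.trans (ht.2.trans htr)
        have h₂ : JLE r s := hmax hr.1 h₁
        exact ⟨h₂.trans hej.2, hej.1.trans h₁⟩)⟩
    have hss : D \ {t | JRel t (c.e j)} ⊂ D :=
      Set.sdiff_subset.ssubset_of_mem_notMem hsD fun h => h.2 ⟨hej.2, hej.1⟩
    have hlow : {t : S | JLE t (c.e j) ∧ ¬ JLE (c.e j) t} ⊆ D \ {t | JRel t (c.e j)} :=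
      fun t ht => ⟨hD (ht.1.trans hej.1) hsD, fun h => ht.2 h.2⟩
    have hbelow : {t : S | JLE t (c.e j)} ⊆ D := fun t ht => hD (ht.trans hej.1) hsD
    obtain ⟨M, hM⟩ := h j
    have hMD := spanOf_mono (k := k) hbelow (c.ofMatrix_mem j M)
    refine (ih _ hss hD').extend hD Set.sdiff_subset hMD fun t ht => ?_
    by_cases htj : JRel t (c.e j)
    · obtain ⟨a, ⟨ha, hat⟩, -⟩ := c.T'_rep j t
        ((jClass_eq_iff.mpr htj).trans (c.mem j))
      obtain ⟨x, rfl⟩ := hat.2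
      have := c.ofMatrix_mul_sub_mem j M ⟨a, ha⟩
      rw [hM, sum_of_mul_one] at this
      rw [map_mul, ← mul_assoc, ← sub_mul]
      exact hD'.mul_mem_right (spanOf_mono hlow this) _
    · exact sub_mem (hD'.mul_mem_left (of_mem_spanOf ⟨ht, htj⟩) _) (of_mem_spanOf ⟨ht, htj⟩)

/-- Every element of the `J`-class `j` has the form `ρgλ` with `ρ ∈ T'_j`, `g ∈ G_j`, `λ ∈ T_j`. -/
theorem exists_coordinates [Finite S] {j : JClass S} {s : S} (hs : JRel s (c.e j)) :
    ∃ (a : c.T' j) (g : c.G j) (b : c.T j),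
      s = a.1 * MaximalSubgroup.incl (c.idem j) g * b.1 := by
  have hsj : jClass s = j := (jClass_eq_iff.mpr hs).trans (c.mem j)
  have hee : c.e j * c.e j = c.e j := c.idem j
  obtain ⟨a, ⟨ha, has⟩, -⟩ := c.T'_rep j s hsj
  obtain ⟨b, ⟨hb, hbs⟩, -⟩ := c.T_rep j s hsj
  obtain ⟨x, hx⟩ := has.2
  obtain ⟨y, hy⟩ := hbs.2
  obtain ⟨z, hz⟩ := (c.T'_sub j a ha).2
  obtain ⟨w, hw⟩ := (c.T_sub j b hb).2
  have hae := c.mul_e_of_mem_T' ha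
  have heb := c.e_mul_of_mem_T hb
  have haz : a * z * s = s := by
    rw [hx, ← mul_assoc, mul_assoc a z a, ← hz, hae]
  have hwb : s * w * b = s := by
    rw [hy, mul_assoc y b w, ← hw, mul_assoc, heb]
  have key : a * (c.e j * z * s * w * c.e j) * b = s := by
    calc a * (c.e j * z * s * w * c.e j) * b = (a * c.e j) * z * s * w * (c.e j * b) := by
          simp only [mul_assoc]
      _ = s := by rw [hae, heb, haz, hwb]
  have hle : JLE s (c.e j * z * s * w * c.e j) := ⟨a, b, key.symm⟩
  obtain ⟨g, hg⟩ := exists_incl_eq (c.idem j) (x := c.e j * z * s * w * c.e j)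
    (by simp only [← mul_assoc, hee]) (by simp only [mul_assoc, hee])
    ⟨JLE.mul_left _ _, hs.2.trans hle⟩
  exact ⟨⟨a, ha⟩, g, ⟨b, hb⟩, by rw [hg, key]⟩

open Classical in
/-- Every element of `kS` below the `J`-class `j` has a coordinate matrix, modulo the elements
strictly below. -/
theorem exists_matrix [Finite S] (j : JClass S) {x : MonoidAlgebra k S}
    (hx : x ∈ spanOf k {s : S | JLE s (c.e j)}) :
    ∃ M : Matrix (c.T' j) (c.T j) (MonoidAlgebra k (c.G j)),
      x - c.ofMatrix j M ∈ spanOf k {s : S | JLE s (c.e j) ∧ ¬ JLE (c.e j) s} := by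
  unfold spanOf at hx
  induction hx using Submodule.span_induction with
  | zero => exact ⟨0, by simp [ofMatrix]⟩
  | add x y _ _ hx hy =>
    obtain ⟨M, hM⟩ := hx
    obtain ⟨N, hN⟩ := hy
    refine ⟨M + N, ?_⟩
    have : c.ofMatrix j (M + N) = c.ofMatrix j M + c.ofMatrix j N := by
      simp only [ofMatrix, Matrix.add_apply, map_add, mul_add, add_mul, Finset.sum_add_distrib]
    rw [this, add_sub_add_comm]
    exact add_mem hM hN
  | smul r x _ hx =>
    obtain ⟨M, hM⟩ := hx
    refine ⟨r • M, ?_⟩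
    have : c.ofMatrix j (r • M) = r • c.ofMatrix j M := by
      simp only [ofMatrix, Matrix.smul_apply, groupIncl_smul, mul_smul_comm, smul_mul_assoc,
        Finset.smul_sum]
    rw [this, ← smul_sub]
    exact Submodule.smul_mem _ _ hM
  | mem x hx =>
    obtain ⟨s, hs, rfl⟩ := hx
    by_cases hse : JLE (c.e j) s
    · obtain ⟨a, g, b, hab⟩ := c.exists_coordinates (j := j) ⟨hs, hse⟩
      refine ⟨Matrix.single a b (of k _ g), ?_⟩
      have : c.ofMatrix j (Matrix.single a b (of k (c.G j) g)) = of k S s := by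
        rw [ofMatrix, Finset.sum_eq_single_of_mem a (Finset.mem_univ _),
          Finset.sum_eq_single_of_mem b (Finset.mem_univ _)]
        · rw [Matrix.single_apply_same, groupIncl_of, hab, map_mul, map_mul]
        · intro b' _ hb'
          rw [Matrix.single_apply_of_col_ne _ _ hb'.symm, map_zero, mul_zero, zero_mul]
        · intro a' _ ha'
          refine Finset.sum_eq_zero fun b' _ => ?_
          rw [Matrix.single_apply_of_row_ne ha'.symm, map_zero, mul_zero, zero_mul]
      rw [this, sub_self]
      exact zero_mem _
    · have hmem : of k S s ∈ spanOf k {s : S | JLE s (c.e j) ∧ ¬ JLE (c.e j) s} :=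
        of_mem_spanOf ⟨hs, hse⟩
      exact ⟨0, by simpa [ofMatrix] using hmem⟩

/-- The elements `ρg` with `ρ ∈ T'_j` and `g ∈ G_j` are pairwise distinct. -/
theorem mul_incl_injective {j : JClass S} {a a' : c.T' j} {g g' : c.G j}
    (h : a.1 * MaximalSubgroup.incl (c.idem j) g = a'.1 * MaximalSubgroup.incl (c.idem j) g') :
    a = a' ∧ g = g' := by
  have hinv : ∀ (a : c.T' j) (g : c.G j), a.1 * MaximalSubgroup.incl (c.idem j) g *
      MaximalSubgroup.incl (c.idem j) g⁻¹ = a.1 := fun a g => by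
    rw [mul_assoc, ← map_mul, mul_inv_cancel]
    exact c.mul_e_of_mem_T' a.2
  have haa : a = a' := by
    have hR : RRel a.1 a'.1 := by
      constructor
      · exact ⟨MaximalSubgroup.incl (c.idem j) g' * MaximalSubgroup.incl (c.idem j) g⁻¹, by
          rw [← mul_assoc, ← h, hinv]⟩
      · exact ⟨MaximalSubgroup.incl (c.idem j) g * MaximalSubgroup.incl (c.idem j) g'⁻¹, by
          rw [← mul_assoc, h, hinv]⟩
    refine Subtype.ext ((c.T'_rep j a'.1 ?_).unique ⟨a.2, hR⟩ ⟨a'.2, ⟨1, ?_⟩, ⟨1, ?_⟩⟩)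
    · exact (jClass_eq_iff.mpr (c.jRel_of_mem_T' a'.2)).trans (c.mem j)
    all_goals rw [mul_one]
  subst haa
  refine ⟨rfl, Units.ext (Subtype.ext ?_)⟩
  obtain ⟨z, hz⟩ := (c.T'_sub j a.1 a.2).2
  have hcancel : ∀ g : c.G j, z * (a.1 * MaximalSubgroup.incl (c.idem j) g) = g.val.val :=
    fun g => by
      rw [← mul_assoc, ← hz]
      exact g.val.2.1
  rw [← hcancel g, h, hcancel]

open Classical in
theorem coeff_of_mul_groupIncl {j : JClass S} (a a' : c.T' j) (g : c.G j)
    (x : MonoidAlgebra k (c.G j)) :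
    (of k S a.1 * groupIncl k (c.idem j) x).coeff
      (a'.1 * MaximalSubgroup.incl (c.idem j) g) = if a = a' then x.coeff g else 0 := by
  induction x using MonoidAlgebra.induction_on with
  | of h =>
    rw [groupIncl_of, ← map_mul, MonoidAlgebra.of_apply, MonoidAlgebra.of_apply,
      MonoidAlgebra.coeff_single, MonoidAlgebra.coeff_single, Finsupp.single_apply,
      Finsupp.single_apply, ← ite_and]
    refine if_congr ⟨c.mul_incl_injective, ?_⟩ rfl rfl
    rintro ⟨rfl, rfl⟩
    rfl
  | add x y hx hy =>
    rw [map_add, mul_add, MonoidAlgebra.coeff_add, Finsupp.add_apply, hx, hy]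
    split_ifs <;> simp
  | smul r x hx =>
    rw [groupIncl_smul, mul_smul_comm, MonoidAlgebra.coeff_smul, Finsupp.smul_apply, hx]
    split_ifs <;> simp

/-- The elements `ρg` are linearly independent modulo the elements strictly below the
`J`-class. -/
theorem eq_zero_of_sum_mem (j : JClass S) (x : c.T' j → MonoidAlgebra k (c.G j))
    (hx : ∑ a, of k S a.1 * groupIncl k (c.idem j) (x a) ∈
      spanOf k {s : S | JLE s (c.e j) ∧ ¬ JLE (c.e j) s}) : x = 0 := by
  classical
  funext a
  ext g
  have hJ : JRel (a.1 * MaximalSubgroup.incl (c.idem j) g) (c.e j) := by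
    have ha := c.jRel_of_mem_T' a.2
    refine ⟨(JLE.mul_right _ _).trans ha.1, ha.2.trans ?_⟩
    have := JLE.mul_right (a.1 * MaximalSubgroup.incl (c.idem j) g)
      (MaximalSubgroup.incl (c.idem j) g⁻¹)
    rw [mul_assoc, ← map_mul, mul_inv_cancel] at this
    have h1 : a.1 * MaximalSubgroup.incl (c.idem j) 1 = a.1 := c.mul_e_of_mem_T' a.2
    rwa [h1] at this
  have h0 := coeff_eq_zero_of_mem_spanOf hx (s := a.1 * MaximalSubgroup.incl (c.idem j) g)
    fun h => h.2 hJ.2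
  rw [MonoidAlgebra.coeff_sum, Finsupp.finsetSum_apply] at h0
  simp only [coeff_of_mul_groupIncl] at h0
  rwa [Finset.sum_ite_eq' Finset.univ a, if_pos (Finset.mem_univ a)] at h0

/-- A left identity of the ideal below `e_j` yields a left inverse of the sandwich matrix. -/
theorem leftInvertible_of_hasLeftIdentity [Finite S] (j : JClass S)
    (h : HasLeftIdentity k {s : S | JLE s (c.e j)}) : LeftInvertible (c.sandwich k j) := by
  classical
  obtain ⟨η, hη, hid⟩ := h
  obtain ⟨M, hM⟩ := c.exists_matrix j hη
  refine ⟨M, Matrix.ext fun a' a => ?_⟩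
  have h₁ := c.ofMatrix_mul_sub_mem j M a
  have h₂ := (isIdealSet_strictlyBelow (c.e j)).mul_mem_right hM (of k S a.1)
  rw [sub_mul, hid _ (of_mem_spanOf (c.jRel_of_mem_T' a.2).1)] at h₂
  have h₃ := neg_mem (add_mem h₂ h₁)
  rw [sub_add_sub_cancel, neg_sub] at h₃
  have h₄ := c.eq_zero_of_sum_mem j (fun a' => (M * c.sandwich k j) a' a - (1 : Matrix _ _ _) a' a)
    (by
      simp only [map_sub, mul_sub, Finset.sum_sub_distrib]
      rw [sum_of_mul_one]
      exact h₃)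
  rw [sub_eq_zero.mp (congrFun h₄ a')]
  simp only [Matrix.one_apply]
  congr

end Representatives

/-! ### Projectivity of the modules `e(kS/kI)` -/

section EQuotProjective

open MulOpposite

open MonoidAlgebra (of)

variable (k : Type u) [Field k] {S : Type v} [Monoid S] {e : S} (he : IsIdempotentElem e)

namespace EQuot

/-- The class of `e`, a generator of the right `kS`-module `e(kS/kI)`. -/
def gen : EQuot k he :=
  ⟨toQuot k e (of k S e), by rw [mem_eQuotSubgroup, ← map_mul, ← map_mul, he]⟩

variable {k}

@[ext]
theorem ext {p q : EQuot k he} (h : p.1 = q.1) : p = q := Subtype.ext h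

theorem smul_val (a : (MonoidAlgebra k S)ᵐᵒᵖ) (q : EQuot k he) :
    (a • q).1 = q.1 * toQuot k e a.unop := rfl

theorem group_smul_val (b : MonoidAlgebra k (MaximalSubgroup he)) (q : EQuot k he) :
    (b • q).1 = toQuot k e (groupIncl k he b) * q.1 := rfl

theorem smul_gen_val (a : MonoidAlgebra k S) :
    (op a • gen k he).1 = toQuot k e (of k S e * a) := (map_mul (toQuot k e) _ _).symm

theorem exists_smul_gen (q : EQuot k he) : ∃ a : MonoidAlgebra k S, op a • gen k he = q := by
  obtain ⟨a, ha⟩ := Ideal.Quotient.mk_surjective q.1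
  refine ⟨a, EQuot.ext he ?_⟩
  rw [smul_gen_val, map_mul]
  change _ * toQuot k e a = _
  rw [show toQuot k e a = q.1 from ha]
  exact q.2

theorem smul_gen_eq_zero {s : S} (hs : ¬ JLE e s) : op (of k S s) • gen k he = 0 := by
  refine EQuot.ext he ?_
  rw [smul_gen_val, ← map_mul]
  exact Ideal.Quotient.eq_zero_iff_mem.mpr (mem_notAboveIdeal.mpr
    (of_mem_spanOf fun h => hs (h.trans (JLE.mul_left _ _))))

/-- Elements which are not above `e` annihilate `e(kS/kI)`. -/
theorem smul_eq_zero {s : S} (hs : ¬ JLE e s) (q : EQuot k he) : op (of k S s) • q = 0 := by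
  refine EQuot.ext he ?_
  rw [smul_val, unop_op, show toQuot k e (of k S s) = 0 from
    Ideal.Quotient.eq_zero_iff_mem.mpr (mem_notAboveIdeal.mpr (of_mem_spanOf hs)), mul_zero]
  rfl

theorem smul_gen (b : MonoidAlgebra k (MaximalSubgroup he)) :
    b • gen k he = op (groupIncl k he b) • gen k he := by
  refine EQuot.ext he ?_
  rw [group_smul_val, smul_gen_val, ← of_mul_groupIncl]
  exact (map_mul (toQuot k e) _ _).symm.trans (by rw [groupIncl_mul_of])

/-- A left identity `η` of `kI` splits the projection `kS → e(kS/kI)`, by `q ↦ (1 - η)q`. -/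
theorem projective_of_hasLeftIdentity (h : HasLeftIdentity k {s : S | ¬ JLE e s}) :
    Module.Projective (MonoidAlgebra k S)ᵐᵒᵖ (EQuot k he) := by
  obtain ⟨η, hη, hid⟩ := h
  -- Multiplication by `1 - η` kills `kI`, so the choice of representatives in `kS` is immaterial.
  choose r hr using fun q : EQuot k he => Ideal.Quotient.mk_surjective (I := notAboveIdeal k e) q.1
  have key : ∀ x y : MonoidAlgebra k S, toQuot k e x = toQuot k e y →
      (1 - η) * x = (1 - η) * y := fun x y h => by
    rw [← sub_eq_zero, ← mul_sub, sub_mul, one_mul, hid _ (toQuot_eq_iff.mp h), sub_self]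
  let i : EQuot k he →ₗ[(MonoidAlgebra k S)ᵐᵒᵖ] (MonoidAlgebra k S)ᵐᵒᵖ :=
    { toFun := fun q => op ((1 - η) * r q)
      map_add' := fun p q => by
        rw [← op_add, ← mul_add, key (r (p + q)) (r p + r q)]
        rw [map_add]
        exact (hr _).trans (congrArg₂ (· + ·) (hr p).symm (hr q).symm)
      map_smul' := fun a q => by
        rw [RingHom.id_apply, smul_eq_mul, ← op_unop a, ← op_mul, mul_assoc,
          key (r (op a.unop • q)) (r q * a.unop)]
        rw [map_mul]
        exact (hr _).trans (congrArg (· * toQuot k e a.unop) (hr q).symm) }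
  refine Module.Projective.of_split i (LinearMap.toSpanSingleton _ _ (gen k he))
    (LinearMap.ext fun q => EQuot.ext he ?_)
  change (op ((1 - η) * r q) • gen k he).1 = q.1
  have h0 : toQuot k e η = 0 := Ideal.Quotient.eq_zero_iff_mem.mpr (mem_notAboveIdeal.mpr hη)
  rw [smul_gen_val, map_mul, map_mul, map_sub, map_one, h0, sub_zero, one_mul,
    show toQuot k e (r q) = q.1 from hr q]
  exact q.2

/-- If `e(kS/kI)` is projective, then the class of `e` lifts to an element of `e(kS)e` which
annihilates `I`: the image of the class under a section of `kS → e(kS/kI)`. -/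
theorem exists_lift_of_projective [Module.Projective (MonoidAlgebra k S)ᵐᵒᵖ (EQuot k he)] :
    ∃ f : MonoidAlgebra k S, f - of k S e ∈ spanOf k {s : S | JLE s e ∧ ¬ JLE e s} ∧
      ∀ s, ¬ JLE e s → f * of k S s = 0 := by
  obtain ⟨i, hi⟩ := Module.projective_lifting_property
    (LinearMap.toSpanSingleton (MonoidAlgebra k S)ᵐᵒᵖ _ (gen k he)) LinearMap.id fun q => by
      obtain ⟨a, ha⟩ := exists_smul_gen he q
      exact ⟨op a, ha⟩
  have hig : i (gen k he) • gen k he = gen k he := LinearMap.congr_fun hi (gen k he)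
  have hee : of k S e * of k S e = of k S e := by rw [← map_mul, he]
  set f := (i (gen k he)).unop with hf
  have hfe : f * of k S e = f := by
    have h1 : op (of k S e) • gen k he = gen k he := EQuot.ext he (by
      rw [smul_gen_val, hee]; rfl)
    conv_rhs => rw [hf, ← h1, map_smul]
    rfl
  refine ⟨of k S e * f, ?_, fun s hs => ?_⟩
  · have h1 : of k S e * f - of k S e ∈ spanOf k {s : S | ¬ JLE e s} := by
      rw [← toQuot_eq_iff, ← smul_gen_val he f]
      exact congrArg Subtype.val hig
    have h2 : of k S e * f - of k S e =
        of k S e * (of k S e * f - of k S e) * of k S e := by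
      rw [mul_sub, sub_mul, hee, hee, ← mul_assoc, hee, mul_assoc, hfe]
    rw [h2]
    refine mul_mul_mem_of_forall (fun s hs => ?_) h1
    rw [← map_mul, ← map_mul]
    exact of_mem_spanOf ⟨JLE.mul_left _ _, fun h => hs (h.trans ⟨e, e, rfl⟩)⟩
  · have h1 : op (of k S s) * i (gen k he) = 0 := by
      rw [← smul_eq_mul, ← map_smul, smul_gen_eq_zero he hs, map_zero]
    rw [mul_assoc, show f * of k S s = 0 from congrArg unop h1, mul_zero]

end EQuot

end EQuotProjective

namespace Representatives

variable {S : Type v} [Monoid S] (c : Representatives S) {k : Type u} [Field k]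

open MonoidAlgebra (of)

/-- If the modules `e(kS/kI)` are projective, then the ideals of `kS` spanned by ideals `D` of `S`
have left identities. This goes down from `S`: for a `J`-class `J` minimal outside `D`, an element
`xey` of `J` is congruent modulo `kD` to an element `xfy` annihilating `D`, so that a left identity
of `k(D ∪ J)` can be corrected to lie in `kD`. -/
theorem hasLeftIdentity_of_projective [Finite S]
    (h : ∀ j, Module.Projective (MonoidAlgebra k S)ᵐᵒᵖ (EQuot k (c.idem j)))
    (D : Set S) (hD : IsIdealSet D) : HasLeftIdentity k D := by
  induction D using WellFoundedGT.induction with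
  | ind D ih =>
    rcases Dᶜ.eq_empty_or_nonempty with h0 | hne
    · rw [Set.compl_empty_iff] at h0
      subst h0
      exact ⟨1, mem_spanOf_univ 1, fun y _ => one_mul y⟩
    obtain ⟨s, hsD, hmin⟩ := Dᶜ.toFinite.exists_minimalFor jClass Dᶜ hne
    set j := jClass s
    have hej : JRel (c.e j) s := jClass_eq_iff.mp (c.mem j)
    have heD : ∀ t ∈ D, ¬ JLE (c.e j) t := fun t ht h => hsD (hD (hej.2.trans h) ht)
    have hlow : {t : S | JLE t (c.e j) ∧ ¬ JLE (c.e j) t} ⊆ D := fun t ht => by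
      by_contra hc
      exact ht.2 (hej.1.trans (hmin hc (ht.1.trans hej.1)))
    have hD' : IsIdealSet (D ∪ {t | JRel t (c.e j)}) := fun t r htr hr => by
      rcases hr with hr | hr
      · exact Or.inl (hD htr hr)
      · by_cases ht : JLE (c.e j) t
        · exact Or.inr ⟨htr.trans hr.1, ht⟩
        · exact Or.inl (hlow ⟨htr.trans hr.1, ht⟩)
    have hss : D ⊂ D ∪ {t | JRel t (c.e j)} :=
      Set.subset_union_left.ssubset_of_mem_notMem (Or.inr ⟨hej.2, hej.1⟩) hsD
    obtain ⟨f, hf, hf0⟩ := EQuot.exists_lift_of_projective (k := k) (c.idem j)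
    -- Up to `kD`, every element of `k(D ∪ J)` agrees with one which annihilates `D`.
    have hcorr : ∀ x ∈ spanOf k (D ∪ {t | JRel t (c.e j)}),
        ∃ ν : MonoidAlgebra k S, x - ν ∈ spanOf k D ∧ ∀ y ∈ spanOf k D, ν * y = 0 := by
      intro x hx
      unfold spanOf at hx
      induction hx using Submodule.span_induction with
      | zero => exact ⟨0, by simp, by simp⟩
      | add x y _ _ hx hy =>
        obtain ⟨ν, h₁, h₂⟩ := hx
        obtain ⟨ν', h₁', h₂'⟩ := hy
        refine ⟨ν + ν', ?_, fun z hz => by rw [add_mul, h₂ z hz, h₂' z hz, add_zero]⟩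
        rw [add_sub_add_comm]
        exact add_mem h₁ h₁'
      | smul r x _ hx =>
        obtain ⟨ν, h₁, h₂⟩ := hx
        refine ⟨r • ν, ?_, fun z hz => by rw [smul_mul_assoc, h₂ z hz, smul_zero]⟩
        rw [← smul_sub]
        exact Submodule.smul_mem _ _ h₁
      | mem x hx =>
        obtain ⟨t, ht | ht, rfl⟩ := hx
        · exact ⟨0, by rw [sub_zero]; exact of_mem_spanOf ht, by simp⟩
        · obtain ⟨x, y, rfl⟩ := ht.1
          refine ⟨of k S x * f * of k S y, ?_, fun z hz => ?_⟩
          · rw [map_mul, map_mul, ← sub_mul, ← mul_sub, ← neg_sub f, mul_neg, neg_mul]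
            exact neg_mem (hD.mul_mem_right (hD.mul_mem_left (spanOf_mono hlow hf) _) _)
          · have : f * of k S y * z ∈ (⊥ : Submodule k (MonoidAlgebra k S)) :=
              mul_mem_of_forall (fun t ht => by
                rw [mul_assoc, ← map_mul, hf0 _ (heD _ (hD (JLE.mul_left _ _) ht))]
                exact zero_mem _) hz
            rw [mul_assoc, mul_assoc, ← mul_assoc f, (Submodule.mem_bot k).mp this, mul_zero]
    obtain ⟨η, hη, hid⟩ := ih _ hss hD'
    obtain ⟨ν, h₁, h₂⟩ := hcorr η hη
    exact ⟨η - ν, h₁, fun y hy => by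
      rw [sub_mul, hid y (spanOf_mono hss.subset hy), h₂ y hy, sub_zero]⟩

variable (k)

theorem isSemisimpleRing_of_goodChar [Finite S] (h : GoodChar k S) (j : JClass S) :
    IsSemisimpleRing (MonoidAlgebra k (c.G j))ᵐᵒᵖ := by
  have : NeZero (Nat.card (c.G j) : k) := ⟨fun h0 => h _ (c.idem j) ((ringChar.spec k _).mp h0)⟩
  infer_instance

variable {k}

theorem isDirected_iff_projective [Finite S] (hchar : GoodChar k S) :
    c.IsDirected k ↔
      ∀ j, Module.Projective (MonoidAlgebra k S)ᵐᵒᵖ (EQuot k (c.idem j)) := by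
  have hss := c.isSemisimpleRing_of_goodChar k hchar
  constructor
  · rintro ⟨-, h⟩ j
    exact BalancedTensor.projective_of_simple (B := MonoidAlgebra k (c.G j))
      fun V hV => h j V hV
  · refine fun h => ⟨hchar, fun j V _ _ _ => ?_⟩
    have := h j
    have : Module.Projective (MonoidAlgebra k (c.G j))ᵐᵒᵖ V :=
      Module.projective_of_isSemisimpleRing _ _
    exact BalancedTensor.projective

/-- Both sides say that every ideal of `kS` spanned by an ideal of `S` has a left identity. -/
theorem isDirected_iff_leftInvertible [Finite S] (hchar : GoodChar k S) :
    c.IsDirected k ↔ ∀ j, LeftInvertible (c.sandwich k j) := by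
  rw [c.isDirected_iff_projective hchar]
  exact ⟨fun h j => c.leftInvertible_of_hasLeftIdentity j
      (c.hasLeftIdentity_of_projective h _ (isIdealSet_below _)),
    fun h j => EQuot.projective_of_hasLeftIdentity _
      (c.hasLeftIdentity_of_sandwich h _ (isIdealSet_notAbove _))⟩

end Representatives

/-! ### The canonical map `Ind(Me) → M` -/

section Canonical

open MulOpposite

open MonoidAlgebra (of)

variable (k : Type u) [Field k] {S : Type v} [Monoid S] {e : S} (he : IsIdempotentElem e)
  (M : Type w) [AddCommGroup M] [Module (MonoidAlgebra k S)ᵐᵒᵖ M]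

/-- The underlying additive group of `Me`, for a right `kS`-module `M`. -/
def fixedSubgroup (e : S) : AddSubgroup M where
  carrier := {m | op (of k S e) • m = m}
  zero_mem' := smul_zero _
  add_mem' {a b} (ha : _ = _) (hb : _ = _) := by
    change _ = _
    rw [smul_add, ha, hb]
  neg_mem' {a} (ha : _ = _) := by
    change _ = _
    rw [smul_neg, ha]

/-- For a right `kS`-module `M`, the right `kG_e`-module `Me`. -/
def Fixed (_ : IsIdempotentElem e) : Type w := fixedSubgroup k M e

instance : AddCommGroup (Fixed k M he) := inferInstanceAs (AddCommGroup (fixedSubgroup k M e))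

instance : Module (MonoidAlgebra k (MaximalSubgroup he))ᵐᵒᵖ (Fixed k M he) where
  smul b m := ⟨op (groupIncl k he b.unop) • m.1, by
    change _ • _ • _ = _ • _
    rw [← mul_smul, ← op_mul, groupIncl_mul_of]⟩
  one_smul m := Subtype.ext (by
    change op (groupIncl k he 1) • m.1 = m.1
    rw [groupIncl_one]
    exact m.2)
  mul_smul a b m := Subtype.ext (by
    change op (groupIncl k he (b.unop * a.unop)) • m.1 =
      op (groupIncl k he a.unop) • op (groupIncl k he b.unop) • m.1
    rw [map_mul, op_mul, mul_smul])
  smul_zero a := Subtype.ext (smul_zero _)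
  zero_smul m := Subtype.ext (by
    change op (groupIncl k he 0) • m.1 = 0
    rw [map_zero, op_zero, zero_smul])
  smul_add a p q := Subtype.ext (smul_add _ _ _)
  add_smul a b m := Subtype.ext (by
    change op (groupIncl k he (a.unop + b.unop)) • m.1 =
      op (groupIncl k he a.unop) • m.1 + op (groupIncl k he b.unop) • m.1
    rw [map_add, op_add, add_smul])

variable {k M}

theorem Fixed.smul_val (b : MonoidAlgebra k (MaximalSubgroup he)) (m : Fixed k M he) :
    (op b • m).1 = op (groupIncl k he b) • m.1 := rfl

/-- The annihilator condition which makes `v · q` meaningful for `v ∈ Me` and `q ∈ e(kS/kI)`. -/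
def KillsNotAbove (k : Type u) [Field k] (M : Type w) [AddCommGroup M]
    [Module (MonoidAlgebra k S)ᵐᵒᵖ M] (e : S) : Prop :=
  ∀ (s : S) (m : M), ¬ JLE e s → op (of k S s) • op (of k S e) • m = 0

theorem op_smul_smul (r : k) (x : MonoidAlgebra k S) (m : M) :
    op (r • x) • m = op (r • (1 : MonoidAlgebra k S)) • op x • m := by
  rw [← mul_smul, ← op_mul, mul_smul_one]

theorem KillsNotAbove.smul_eq (hM : KillsNotAbove k M e) (m : Fixed k M he)
    {x y : MonoidAlgebra k S} (h : toQuot k e x = toQuot k e y) : op x • m.1 = op y • m.1 := by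
  have key : ∀ z ∈ spanOf k {s : S | ¬ JLE e s}, op z • m.1 = 0 := by
    intro z hz
    unfold spanOf at hz
    induction hz using Submodule.span_induction with
    | zero => rw [op_zero, zero_smul]
    | add x y _ _ hx hy => rw [op_add, add_smul, hx, hy, add_zero]
    | smul r x _ hx => rw [op_smul_smul, hx, smul_zero]
    | mem x hx =>
      obtain ⟨s, hs, rfl⟩ := hx
      rw [← show op (of k S e) • m.1 = m.1 from m.2]
      exact hM s m.1 hs
  rw [← sub_eq_zero, ← sub_smul, ← op_sub]
  exact key _ (toQuot_eq_iff.mp h)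

/-- A representative in `kS` of an element of `e(kS/kI)`. -/
def EQuot.rep (q : EQuot k he) : MonoidAlgebra k S :=
  (Ideal.Quotient.mk_surjective (I := notAboveIdeal k e) q.1).choose

theorem EQuot.toQuot_rep (q : EQuot k he) : toQuot k e (q.rep he) = q.1 :=
  (Ideal.Quotient.mk_surjective (I := notAboveIdeal k e) q.1).choose_spec

/-- The canonical `kS`-linear map `Ind(Me) → M`, `v ⊗ q ↦ vq`. -/
def canonicalMap (hM : KillsNotAbove k M e) :
    Ind k he (Fixed k M he) →ₗ[(MonoidAlgebra k S)ᵐᵒᵖ] M :=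
  BalancedTensor.lift (fun q m => op (q.rep he) • m.1)
    (fun p q m => by
      rw [← add_smul, ← op_add]
      refine hM.smul_eq he m ?_
      rw [map_add, EQuot.toQuot_rep, EQuot.toQuot_rep, EQuot.toQuot_rep]
      rfl)
    (fun q m m' => smul_add _ _ _)
    (fun a q m => by
      rw [← op_unop a, ← mul_smul, ← op_mul]
      refine hM.smul_eq he m ?_
      rw [map_mul, EQuot.toQuot_rep, EQuot.toQuot_rep]
      rfl)
    (fun b q m => by
      rw [Fixed.smul_val, ← mul_smul, ← op_mul]
      refine hM.smul_eq he m ?_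
      rw [map_mul, EQuot.toQuot_rep, EQuot.toQuot_rep]
      rfl)

open BalancedTensor (pure)

theorem canonicalMap_smul_gen (hM : KillsNotAbove k M e) (a : MonoidAlgebra k S)
    (m : Fixed k M he) :
    canonicalMap he hM (pure _ _ (op a • EQuot.gen k he) m) = op a • m.1 := by
  have h : op (of k S e * a) • m.1 = op a • m.1 := by
    rw [op_mul, mul_smul]
    exact congrArg (op a • ·) m.2
  rw [← h]
  refine hM.smul_eq he m ?_
  rw [EQuot.toQuot_rep, EQuot.smul_gen_val]

theorem canonicalMap_gen (hM : KillsNotAbove k M e) (m : Fixed k M he) :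
    canonicalMap he hM (pure _ _ (EQuot.gen k he) m) = m.1 := by
  have := canonicalMap_smul_gen he hM 1 m
  rwa [op_one, one_smul, one_smul] at this

/-- `e(kS/kI)e` is the group algebra `kG_e`. -/
theorem EQuot.exists_group_smul [Finite S] (x : MonoidAlgebra k S) :
    ∃ b : MonoidAlgebra k (MaximalSubgroup he), op (x * of k S e) • gen k he = b • gen k he := by
  induction x using MonoidAlgebra.induction_on with
  | of s =>
    have hes : op (of k S s * of k S e) • gen k he = op (of k S (e * s * e)) • gen k he := by
      refine EQuot.ext he ?_
      rw [smul_gen_val, smul_gen_val, ← map_mul, ← map_mul, ← map_mul]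
      simp only [← mul_assoc, show e * e = e from he]
    rw [hes]
    by_cases h : JLE e (e * s * e)
    · obtain ⟨g, hg⟩ := exists_incl_eq he (x := e * s * e)
        (by simp only [← mul_assoc, show e * e = e from he])
        (by simp only [mul_assoc, show e * e = e from he]) ⟨JLE.mul_left _ _, h⟩
      exact ⟨of k _ g, by rw [smul_gen, groupIncl_of, hg]⟩
    · exact ⟨0, by rw [smul_gen_eq_zero he h, zero_smul]⟩
  | add x y hx hy =>
    obtain ⟨b, hb⟩ := hx
    obtain ⟨b', hb'⟩ := hy
    exact ⟨b + b', by rw [add_mul, op_add, add_smul, hb, hb', add_smul]⟩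
  | smul r x hx =>
    obtain ⟨b, hb⟩ := hx
    refine ⟨r • b, ?_⟩
    rw [smul_gen] at hb ⊢
    rw [groupIncl_smul, smul_mul_assoc, op_smul_smul, hb, ← op_smul_smul]

theorem Ind.exists_eq_pure_gen [Finite S] (x : MonoidAlgebra k S)
    (p : Ind k he (Fixed k M he)) :
    ∃ m : Fixed k M he, op (x * of k S e) • p = pure _ _ (EQuot.gen k he) m := by
  induction p using BalancedTensor.induction with
  | h0 => exact ⟨0, by rw [smul_zero, BalancedTensor.pure_zero_right]⟩
  | hadd p q hp hq =>
    obtain ⟨m, hm⟩ := hp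
    obtain ⟨m', hm'⟩ := hq
    exact ⟨m + m', by rw [smul_add, hm, hm', BalancedTensor.pure_add_right]⟩
  | hpure q m =>
    obtain ⟨a, rfl⟩ := EQuot.exists_smul_gen he q
    obtain ⟨b, hb⟩ := EQuot.exists_group_smul he (a * x)
    refine ⟨op b • m, ?_⟩
    rw [BalancedTensor.pure_balanced, ← hb, ← BalancedTensor.pure_smul_left, ← mul_smul, ← op_mul,
      mul_assoc]

/-- `Ind(V)e` is `V` itself, so that the kernel of the canonical map is annihilated by the
`J`-class of `e`. -/
theorem smul_eq_zero_of_mem_ker [Finite S] (hM : KillsNotAbove k M e)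
    {p : Ind k he (Fixed k M he)} (hp : canonicalMap he hM p = 0) {s : S} (hs : JLE s e) :
    op (of k S s) • p = 0 := by
  obtain ⟨x, y, rfl⟩ := hs
  rw [map_mul, map_mul, op_mul, mul_smul]
  obtain ⟨m, hm⟩ := Ind.exists_eq_pure_gen he (of k S x) p
  have h0 : m = 0 := Subtype.ext (by
    rw [← canonicalMap_gen he hM m, ← hm, map_smul, hp, smul_zero]
    rfl)
  rw [hm, h0, BalancedTensor.pure_zero_right, smul_zero]

theorem Ind.smul_eq_zero {V : Type w} [AddCommGroup V]
    [Module (MonoidAlgebra k (MaximalSubgroup he))ᵐᵒᵖ V] {s : S} (hs : ¬ JLE e s)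
    (p : Ind k he V) : op (of k S s) • p = 0 := by
  induction p using BalancedTensor.induction with
  | h0 => exact smul_zero _
  | hadd p q hp hq => rw [smul_add, hp, hq, add_zero]
  | hpure q m =>
    rw [← BalancedTensor.pure_smul_left, EQuot.smul_eq_zero he hs, BalancedTensor.pure_zero_left]

/-- The image of the canonical map is `MeS`. -/
theorem smul_mem_range (hM : KillsNotAbove k M e) {s : S} (hs : JLE s e) (m : M) :
    op (of k S s) • m ∈ LinearMap.range (canonicalMap he hM) := by
  obtain ⟨x, y, rfl⟩ := hs
  rw [map_mul, map_mul, op_mul, mul_smul]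
  let n : Fixed k M he := ⟨op (of k S x * of k S e) • m, by
    change _ • _ • _ = _ • _
    rw [← mul_smul, ← op_mul, mul_assoc, ← map_mul, he]⟩
  exact ⟨pure _ _ (op (of k S y) • EQuot.gen k he) n, canonicalMap_smul_gen he hM _ n⟩

end Canonical

/-! ### Projective dimension -/

section ProjectiveDimension

open CategoryTheory

theorem hasProjectiveDimensionLT_of_ker_of_coker {R : Type w} [Ring R] {P M : Type w}
    [AddCommGroup P] [Module R P] [AddCommGroup M] [Module R M] [Module.Projective R P]
    (f : P →ₗ[R] M) (n : ℕ)
    (hK : HasProjectiveDimensionLT (ModuleCat.of R (LinearMap.ker f)) n)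
    (hC : HasProjectiveDimensionLT (ModuleCat.of R (M ⧸ LinearMap.range f)) (n + 1)) :
    HasProjectiveDimensionLT (ModuleCat.of R M) (n + 1) := by
  have hP : Projective (ModuleCat.of R P) := (IsProjective.iff_projective P).mp inferInstance
  have h₁ := LinearMap.shortExact_shortComplexKer f.surjective_rangeRestrict
  have h₂ := LinearMap.shortExact_shortComplexKer (LinearMap.range f).mkQ_surjective
  have hR : HasProjectiveDimensionLT (ModuleCat.of R (LinearMap.range f)) (n + 1) :=
    h₁.hasProjectiveDimensionLT_X₃ n (by
      change HasProjectiveDimensionLT (ModuleCat.of R (LinearMap.ker f.rangeRestrict)) n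
      rwa [LinearMap.ker_rangeRestrict])
      (by
        change HasProjectiveDimensionLT (ModuleCat.of R P) (n + 1)
        rw [add_comm]
        infer_instance)
  refine h₂.hasProjectiveDimensionLT_X₂ (n + 1) ?_ hC
  change HasProjectiveDimensionLT (ModuleCat.of R (LinearMap.ker (LinearMap.range f).mkQ)) (n + 1)
  rwa [Submodule.ker_mkQ]

theorem hasProjectiveDimensionLT_of_subsingleton {R : Type w} [Ring R] (M : Type w)
    [AddCommGroup M] [Module R M] [Subsingleton M] (n : ℕ) :
    HasProjectiveDimensionLT (ModuleCat.of R M) n := by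
  have := (ModuleCat.isZero_of_subsingleton (ModuleCat.of R M)).hasProjectiveDimensionLT_zero
  exact hasProjectiveDimensionLT_of_ge _ 0 n (Nat.zero_le n)

end ProjectiveDimension

namespace Representatives

variable {S : Type v} [Monoid S] (c : Representatives S) {k : Type u} [Field k]

open CategoryTheory MulOpposite

open MonoidAlgebra (of)

instance [Finite S] : Finite (JClass S) := inferInstanceAs (Finite (Quotient (jSetoid S)))

theorem projective_ind [Finite S] (h : c.IsDirected k) (j : JClass S) (V : Type w)
    [AddCommGroup V] [Module (MonoidAlgebra k (c.G j))ᵐᵒᵖ V] :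
    Module.Projective (MonoidAlgebra k S)ᵐᵒᵖ (Ind k (c.idem j) V) := by
  have := c.isSemisimpleRing_of_goodChar k h.1 j
  have := (c.isDirected_iff_projective h.1).mp h j
  have : Module.Projective (MonoidAlgebra k (c.G j))ᵐᵒᵖ V :=
    Module.projective_of_isSemisimpleRing _ _
  exact BalancedTensor.projective

/-- A module on which only the `J`-classes of an upper set `U` act nontrivially has projective
dimension less than the length of the longest chain in `U`. For a minimal element `j` of `U`, the
canonical map `Ind_j(Me_j) → M` has its kernel supported strictly above `j`, and its cokernel
supported in `U \ {j}`. -/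
theorem hasProjectiveDimensionLT_of_upperSet [Finite S] (h : c.IsDirected k) (U : Set (JClass S))
    (hU : IsUpperSet U) (n : ℕ)
    (hn : ∀ t ⊆ U, IsChain (· ≤ ·) t → t.encard ≤ n) (M : Type (max u v)) [AddCommGroup M]
    [Module (MonoidAlgebra k S)ᵐᵒᵖ M]
    (hM : ∀ (s : S) (m : M), jClass s ∉ U → op (of k S s) • m = 0) :
    HasProjectiveDimensionLT (ModuleCat.of (MonoidAlgebra k S)ᵐᵒᵖ M) n := by
  induction U using WellFoundedLT.induction generalizing n M with
  | ind U ih =>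
    rcases U.eq_empty_or_nonempty with rfl | hne
    · have : Subsingleton M := ⟨fun a b => by
        rw [← one_smul (MonoidAlgebra k S)ᵐᵒᵖ a, ← one_smul (MonoidAlgebra k S)ᵐᵒᵖ b, ← op_one,
          ← map_one (of k S), hM 1 a (Set.notMem_empty _), hM 1 b (Set.notMem_empty _)]⟩
      exact hasProjectiveDimensionLT_of_subsingleton M n
    obtain ⟨j, hj⟩ := U.toFinite.exists_minimal hne
    have hej : jClass (c.e j) = j := c.mem j
    have hle : ∀ s, JLE (c.e j) s ↔ j ≤ jClass s := fun s => by
      rw [← jClass_le_iff, hej]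
    have hge : ∀ s, JLE s (c.e j) ↔ jClass s ≤ j := fun s => by
      rw [← jClass_le_iff, hej]
    obtain ⟨n, rfl⟩ : ∃ n', n = n' + 1 := Nat.exists_eq_succ_of_ne_zero (by
      rintro rfl
      have := hn {j} (Set.singleton_subset_iff.mpr hj.1) IsChain.singleton
      simp at this)
    -- If `s` is not above `e`, then `es` is strictly below `e`, hence outside `U` by minimality.
    have hkill : KillsNotAbove k M (c.e j) := fun s m hs => by
      rw [← mul_smul, ← op_mul, ← map_mul]
      refine hM _ _ fun hmem => hs ?_
      have h1 : jClass (c.e j * s) ≤ j := (hge _).mp (JLE.mul_right _ _)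
      exact ((hle _).mpr (hj.2 hmem h1)).trans (JLE.mul_left _ _)
    have := c.projective_ind h j (Fixed k M (c.idem j))
    refine hasProjectiveDimensionLT_of_ker_of_coker (canonicalMap (c.idem j) hkill) n ?_ ?_
    · refine ih {i | j < i} ⟨fun i hi => hU hi.le hj.1, fun hs => lt_irrefl j (hs hj.1)⟩
        (fun a b hab (ha : j < a) => ha.trans_le hab) n (fun t ht hc => ?_) _ fun s p hs => ?_
      · have hjt : j ∉ t := fun h => lt_irrefl j (ht h)
        have := hn (insert j t) (Set.insert_subset hj.1 fun i hi => hU (ht hi).le hj.1)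
          (hc.insert fun i hi _ => Or.inl (ht hi).le)
        rw [Set.encard_insert_of_notMem hjt, Nat.cast_add, Nat.cast_one] at this
        exact (ENat.add_le_add_iff_right ENat.one_ne_top).mp this
      · refine Subtype.ext ?_
        by_cases hjs : JLE (c.e j) s
        · refine smul_eq_zero_of_mem_ker (c.idem j) hkill p.2 ((hge s).mpr ?_)
          by_contra hsj
          exact hs (((hle s).mp hjs).lt_of_not_ge hsj)
        · exact Ind.smul_eq_zero (c.idem j) hjs p.1
    · refine ih (U \ {j}) ⟨Set.sdiff_subset, fun hs => (hs hj.1).2 rfl⟩ (fun a b hab ha => ?_)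
        (n + 1) (fun t ht hc => hn t (ht.trans Set.sdiff_subset) hc) _ fun s m hs => ?_
      · refine ⟨hU hab ha.1, fun hb => ha.2 ?_⟩
        have hb' : b = j := hb
        exact le_antisymm (hb' ▸ hab) (hj.2 ha.1 (hb' ▸ hab))
      · induction m using Submodule.Quotient.induction_on with
        | H m =>
          rw [← Submodule.Quotient.mk_smul, Submodule.Quotient.mk_eq_zero]
          by_cases hsU : jClass s ∈ U
          · have hsj : jClass s = j := by
              by_contra hne
              exact hs ⟨hsU, hne⟩
            exact smul_mem_range _ hkill ((hge s).mpr hsj.le) m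
          · rw [hM s m hsU]
            exact zero_mem _

theorem of_mul_mul_of_zero {z : S} (hz : ∀ s : S, s * z = z ∧ z * s = z) (a : MonoidAlgebra k S) :
    of k S z * a * of k S z = of k S z * a := by
  induction a using MonoidAlgebra.induction_on with
  | of s => rw [← map_mul, ← map_mul, (hz s).2, (hz z).1]
  | add x y hx hy => rw [mul_add, add_mul, hx, hy]
  | smul r x hx => rw [mul_smul_comm, smul_mul_assoc, hx]

/-- A zero element does not contribute to the projective dimension: for the class of a zero the
canonical map is injective. -/
theorem hasProjectiveDimensionLT_of_isDirected [Finite S] (h : c.IsDirected k) (n : ℕ)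
    (hn : ∀ t ⊆ nonzeroJClasses S, IsChain (· ≤ ·) t → t.encard ≤ (n + 1 : ℕ))
    (M : Type (max u v)) [AddCommGroup M] [Module (MonoidAlgebra k S)ᵐᵒᵖ M] :
    HasProjectiveDimensionLT (ModuleCat.of (MonoidAlgebra k S)ᵐᵒᵖ M) (n + 1) := by
  by_cases hz : Nontrivial S ∧ ∃ z : S, ∀ s : S, s * z = z ∧ z * s = z
  · obtain ⟨hS, z, hz⟩ := hz
    have hzle : ∀ s, JLE z s := fun s => ⟨z, 1, by rw [(hz s).2, mul_one]⟩
    set j := jClass z with hj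
    have hlez : ∀ s, JLE s z → s = z := by
      rintro s ⟨x, y, rfl⟩
      rw [(hz x).1, (hz y).2]
    have hez : c.e j = z := hlez _ (jClass_eq_iff.mp (c.mem j)).1
    have hmem : ∀ i, i ∈ nonzeroJClasses S ↔ i ≠ j := fun i => by
      refine not_congr ⟨?_, fun hi => ⟨hS, z, hz, hi.symm⟩⟩
      rintro ⟨-, z', hz', rfl⟩
      rw [hj, ← (hz' z).1, (hz z').2]
    have hkill : KillsNotAbove k M (c.e j) := fun s m hs => absurd (hez ▸ hzle s) hs
    have := c.projective_ind h j (Fixed k M (c.idem j))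
    refine hasProjectiveDimensionLT_of_ker_of_coker (canonicalMap (c.idem j) hkill) n ?_ ?_
    -- As `e` is the zero of `S`, it acts as the identity on `Ind(Me)`, but it annihilates the kernel.
    · have hone : ∀ p : Ind k (c.idem j) (Fixed k M (c.idem j)), op (of k S (c.e j)) • p = p := by
        intro p
        induction p using BalancedTensor.induction with
        | h0 => exact smul_zero _
        | hadd p q hp hq => rw [smul_add, hp, hq]
        | hpure q m =>
          obtain ⟨a, rfl⟩ := EQuot.exists_smul_gen (c.idem j) q
          rw [← BalancedTensor.pure_smul_left]
          congr 1
          refine EQuot.ext (c.idem j) ?_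
          rw [← mul_smul, ← op_mul, EQuot.smul_gen_val, EQuot.smul_gen_val, ← mul_assoc, hez,
            of_mul_mul_of_zero hz]
      have : Subsingleton (LinearMap.ker (canonicalMap (c.idem j) hkill)) :=
        ⟨fun p q => Subtype.ext (by
          rw [← hone p.1, ← hone q.1,
            smul_eq_zero_of_mem_ker (c.idem j) hkill p.2 (JLE.refl _),
            smul_eq_zero_of_mem_ker (c.idem j) hkill q.2 (JLE.refl _)])⟩
      exact hasProjectiveDimensionLT_of_subsingleton _ n
    · refine c.hasProjectiveDimensionLT_of_upperSet h (nonzeroJClasses S) ?_ (n + 1) hn _ ?_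
      · intro a b hab ha
        rw [hmem] at ha ⊢
        rintro rfl
        induction a using Quotient.inductionOn with
        | h s => exact ha (congrArg jClass (hlez s hab))
      · intro s m hs
        rw [hmem, not_not] at hs
        induction m using Submodule.Quotient.induction_on with
        | H m =>
          rw [← Submodule.Quotient.mk_smul, Submodule.Quotient.mk_eq_zero]
          exact smul_mem_range _ hkill (jClass_eq_iff.mp (hs.trans (c.mem j).symm)).1 m
  · have hall : ∀ i, i ∈ nonzeroJClasses S := by
      rintro i ⟨hS, z, hz', -⟩
      exact hz ⟨hS, z, hz'⟩
    exact c.hasProjectiveDimensionLT_of_upperSet h (nonzeroJClasses S) (fun _ _ _ _ => hall _)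
      (n + 1) hn M fun s _ hs => absurd (hall _) hs

theorem nonzeroJClasses_nonempty (S : Type v) [Monoid S] : (nonzeroJClasses S).Nonempty := by
  refine ⟨jClass 1, ?_⟩
  rintro ⟨hS, z, hz, h1⟩
  obtain ⟨x, y, hxy⟩ := (jClass_eq_iff.mp h1).2
  have hz1 : (1 : S) = z := by rw [hxy, (hz x).1, (hz y).2]
  obtain ⟨a, b, hab⟩ := hS
  refine hab ?_
  rw [← mul_one a, ← mul_one b, hz1, (hz a).1, (hz b).1]

theorem globalDimension_le [Finite S] (h : c.IsDirected k) :
    globalDimension (MonoidAlgebra k S) ≤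
      ((longestChain S - 1 : ℕ∞) : WithBot ℕ∞) := by
  have htop : longestChain S ≠ ⊤ := Set.chainHeight_ne_top_of_finite _ _ (Set.toFinite _)
  obtain ⟨m, hm⟩ := ENat.ne_top_iff_exists.mp htop
  have hle : ∀ t ⊆ nonzeroJClasses S, IsChain (· ≤ ·) t → t.encard ≤ m := fun t ht hc => by
    rw [hm]
    exact Set.encard_le_chainHeight_of_isChain _ t ht hc
  obtain ⟨n, rfl⟩ : ∃ n, m = n + 1 := Nat.exists_eq_succ_of_ne_zero (by
    rintro rfl
    obtain ⟨i, hi⟩ := nonzeroJClasses_nonempty S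
    have := hle {i} (Set.singleton_subset_iff.mpr hi) IsChain.singleton
    simp at this)
  have hmn : longestChain S - 1 = (n : ℕ∞) := by
    rw [← hm]
    exact (ENat.natCast_sub (n + 1) 1).symm
  rw [hmn]
  refine iSup_le fun M => (projectiveDimension_le_iff M n).mpr ?_
  exact c.hasProjectiveDimensionLT_of_isDirected h n hle M

end Representatives

end RegularMonoid

end

theorem theorem4p4 {k : Type u} [Field k] {S : Type v} [Monoid S] [Finite S]
    (hreg : ∀ s : S, ∃ t : S, s * t * s = s)
    (hchar : RegularMonoid.GoodChar k S)
    (c : RegularMonoid.Representatives S) :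
    (c.IsDirected k ↔ ∀ j, RegularMonoid.LeftInvertible (c.sandwich k j)) ∧
    (c.IsDirected k →
      RegularMonoid.globalDimension (MonoidAlgebra k S) ≤
        ((RegularMonoid.longestChain S - 1 : ℕ∞) : WithBot ℕ∞)) :=
  ⟨c.isDirected_iff_leftInvertible hchar, c.globalDimension_le⟩
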